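/- Let $k$ be a field with $\operatorname{char}(k)\neq 2$ and let $g\ge 0$. Let $E=E_{g,g}$ be the graded associative $k$-algebra with basis $e_{\mathcal O}$, $e_{p_i}$, $A_i$ (of degree $0$) and $B_i$, $X_i$, $Y_i$ (of degree $1$), $1\le i\le g$, in which $e_{\mathcal O}, e_{p_1},\dots,e_{p_g}$ are orthogonal idempotents with sum $1$, $A_i=e_{p_i}A_ie_{\mathcal O}$, $B_i=e_{\mathcal O}B_ie_{p_i}$, $X_i=e_{\mathcal O}X_ie_{\mathcal O}$, $Y_i=e_{p_i}Y_ie_{p_i}$, $A_iB_i=Y_i$, $B_iA_i=X_i$, and all other products of two of the elements $A_i,B_i,X_i,Y_i$ are zero. For $d\in\mathbb Z$ let $C^n_d$ be the space of $k$-multilinear maps $E^{n}\to E$ that are homogeneous of internal degree $d$, with the Hochschild differential (for homogeneous $a_0$) $$(\delta f)(a_0,\dots,a_n)=(-1)^{d\,|a_0|}a_0f(a_1,\dots,a_n)+\sum_{j=0}^{n-1}(-1)^{j+1}f(\dots,a_ja_{j+1},\dots)+(-1)^{n+1}f(a_0,\dots,a_{n-1})a_n ,$$ and let $HH^n(E)_d$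 be the $n$-th cohomology of $(C^\bullet_d,\delta)$. For $c\in C^3_{-1}$ let $\alpha_{ij}(c)$ be the coefficient of $X_j$ in $c(B_i,Y_i,A_i)$. Then the map $c\mapsto(\alpha_{ij}(c))_{i\neq j}$ on $3$-cocycles of internal degree $-1$ induces a $k$-linear isomorphism of $HH^3(E)_{-1}$ with the space of $g\times g$ matrices over $k$ with zeros on the diagonal. The same holds if $C^\bullet_d$ is replaced by its subcomplex of normalized cochains relative to the subalgebra $R=\langle e_{\mathcal O},e_{p_1},\dots,e_{p_g}\rangle$, that is, maps of $R$-bimodules $(E/R)^{\otimes_R n}\to E$ of degree $d$; for a $3$-cocycle $c$ of degree $-1$ of this kind one has $c(B_i,Y_i,A_i)=\sum_j\alpha_{ij}(c)X_j$. -/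

import Mathlib

noncomputable section

namespace Hochschild

section Graded

variable {k : Type*} [Field k] {A : Type*} [Ring A] [Algebra k A]

/-- Hochschild `n`-cochains of the `k`-algebra `A` with values in `A`: `k`-multilinear maps
`A × ⋯ × A → A` in `n` arguments. -/
abbrev Cochain (k : Type*) [Field k] (A : Type*) [Ring A] [Algebra k A] (n : ℕ) : Type _ :=
  MultilinearMap k (fun _ : Fin n => A) A

/-! Shortcut instances, equal to those of Mathlib, that let Lean form quotients of spaces of
cochains. -/

instance instAddCommGroupCochain (n : ℕ) : AddCommGroup (Cochain k A n) :=
  MultilinearMap.instAddCommGroup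

instance instAddCommMonoidCochain (n : ℕ) : AddCommMonoid (Cochain k A n) :=
  (instAddCommGroupCochain n).toAddCommMonoid

instance instModuleCochain (n : ℕ) : Module k (Cochain k A n) :=
  MultilinearMap.instModule

/-- The linear map `a ↦ (-1) ^ (d * |a|) a` (for homogeneous `a`): the Koszul sign that appears
when an operation of internal degree `d` is moved past `a`. -/
def koszulTwist (𝒜 : ℤ → Submodule k A) [GradedAlgebra 𝒜] (d : ℤ) : A →ₗ[k] A :=
  (DirectSum.toModule k ℤ A fun i => (((d * i).negOnePow : ℤˣ) : ℤ) • (𝒜 i).subtype) ∘ₗ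
    (DirectSum.decomposeLinearEquiv 𝒜).toLinearMap

theorem koszulTwist_of_mem (𝒜 : ℤ → Submodule k A) [GradedAlgebra 𝒜] (d : ℤ) {i : ℤ} {a : A}
    (ha : a ∈ 𝒜 i) : koszulTwist 𝒜 d a = (((d * i).negOnePow : ℤˣ) : ℤ) • a := by
  simp only [koszulTwist, LinearMap.comp_apply, LinearEquiv.coe_coe,
    DirectSum.decomposeLinearEquiv_apply, DirectSum.decompose_of_mem 𝒜 ha]
  exact (DirectSum.toModule_lof (M := fun i => 𝒜 i) k i (⟨a, ha⟩ : 𝒜 i)).trans rfl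

/-- `merge j (a₀, …, aₙ) = (a₀, …, aⱼ aⱼ₊₁, …, aₙ)`. -/
def merge {n : ℕ} (j : Fin n) (v : Fin (n + 1) → A) : Fin n → A :=
  Fin.contractNth j.castSucc (· * ·) v

theorem merge_update {n : ℕ} (j : Fin n) (v : Fin (n + 1) → A) (i : Fin (n + 1)) :
    ∃ (i' : Fin n) (L : A →ₗ[k] A), ∀ x : A,
      merge j (Function.update v i x) = Function.update (merge j v) i' (L x) := by
  refine ⟨j.predAbove i,
    if i = j.castSucc then LinearMap.mulRight k (v j.succ)
    else if i = j.succ then LinearMap.mulLeft k (v j.castSucc) else LinearMap.id, fun x => ?_⟩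
  ext l
  simp only [merge, Fin.contractNth, Function.update_apply, Fin.predAbove]
  rcases i with ⟨i, hi⟩
  rcases j with ⟨j, hj⟩
  rcases l with ⟨l, hl⟩
  simp only [Fin.ext_iff, Fin.lt_def, Fin.castSucc_mk, Fin.succ_mk]
  split_ifs <;> simp_all <;> omega

/-- The value of the Hochschild differential of an `n`-cochain `f` of internal degree `d`:
`(δf)(a₀, …, aₙ) = (-1) ^ (d |a₀|) a₀ f(a₁, …, aₙ)
  + ∑ⱼ (-1) ^ (j + 1) f(a₀, …, aⱼ aⱼ₊₁, …, aₙ) + (-1) ^ (n + 1) f(a₀, …, aₙ₋₁) aₙ`. -/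
def diffFun (𝒜 : ℤ → Submodule k A) [GradedAlgebra 𝒜] (d : ℤ) {n : ℕ}
    (f : Cochain k A n) (v : Fin (n + 1) → A) : A :=
  koszulTwist 𝒜 d (v 0) * f (fun i => v i.succ)
    + ∑ j : Fin n, (-1 : ℤ) ^ ((j : ℕ) + 1) • f (merge j v)
    + (-1 : ℤ) ^ (n + 1) • (f (fun i => v i.castSucc) * v (Fin.last n))

theorem tail_update {A : Type*} {n : ℕ} (v : Fin (n + 1) → A) (i : Fin n) (x : A) :
    (fun l : Fin n => Function.update v i.succ x l.succ)
      = Function.update (fun l : Fin n => v l.succ) i x := by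
  ext l; simp [Function.update_apply]

theorem init_update {A : Type*} {n : ℕ} (v : Fin (n + 1) → A) (i : Fin n) (x : A) :
    (fun l : Fin n => Function.update v i.castSucc x l.castSucc)
      = Function.update (fun l : Fin n => v l.castSucc) i x := by
  ext l; simp [Function.update_apply]

theorem diffFun_update_add (𝒜 : ℤ → Submodule k A) [GradedAlgebra 𝒜] (d : ℤ) {n : ℕ}
    (f : Cochain k A n) (v : Fin (n + 1) → A) (i : Fin (n + 1)) (x y : A) :
    diffFun 𝒜 d f (Function.update v i (x + y))
      = diffFun 𝒜 d f (Function.update v i x) + diffFun 𝒜 d f (Function.update v i y) := by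
  have h1 : ∀ j : Fin n, f (merge j (Function.update v i (x + y)))
      = f (merge j (Function.update v i x)) + f (merge j (Function.update v i y)) := by
    intro j
    obtain ⟨i', L, h⟩ := merge_update (k := k) j v i
    simp [h]
  have h0 : koszulTwist 𝒜 d (Function.update v i (x + y) 0)
        * f (fun l => Function.update v i (x + y) l.succ)
      = koszulTwist 𝒜 d (Function.update v i x 0) * f (fun l => Function.update v i x l.succ)
        + koszulTwist 𝒜 d (Function.update v i y 0)
          * f (fun l => Function.update v i y l.succ) := by
    refine Fin.cases ?_ (fun i => ?_) i
    · simp [add_mul]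
    · simp only [tail_update, MultilinearMap.map_update_add, mul_add]
      simp [(Fin.succ_ne_zero i).symm]
  have h2 : f (fun l => Function.update v i (x + y) l.castSucc)
        * Function.update v i (x + y) (Fin.last n)
      = f (fun l => Function.update v i x l.castSucc) * Function.update v i x (Fin.last n)
        + f (fun l => Function.update v i y l.castSucc)
          * Function.update v i y (Fin.last n) := by
    refine Fin.lastCases ?_ (fun i => ?_) i
    · simp [mul_add, Fin.castSucc_ne_last]
    · simp only [init_update, MultilinearMap.map_update_add, add_mul]
      simp [(Fin.castSucc_ne_last i).symm]
  simp only [diffFun, h0, h1, h2, smul_add, Finset.sum_add_distrib]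
  abel

theorem diffFun_update_smul (𝒜 : ℤ → Submodule k A) [GradedAlgebra 𝒜] (d : ℤ) {n : ℕ}
    (f : Cochain k A n) (v : Fin (n + 1) → A) (i : Fin (n + 1)) (c : k) (x : A) :
    diffFun 𝒜 d f (Function.update v i (c • x)) = c • diffFun 𝒜 d f (Function.update v i x) := by
  have h1 : ∀ j : Fin n, f (merge j (Function.update v i (c • x)))
      = c • f (merge j (Function.update v i x)) := by
    intro j
    obtain ⟨i', L, h⟩ := merge_update (k := k) j v i
    simp [h]
  have h0 : koszulTwist 𝒜 d (Function.update v i (c • x) 0)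
        * f (fun l => Function.update v i (c • x) l.succ)
      = c • (koszulTwist 𝒜 d (Function.update v i x 0)
        * f (fun l => Function.update v i x l.succ)) := by
    refine Fin.cases ?_ (fun i => ?_) i
    · simp
    · simp only [tail_update, MultilinearMap.map_update_smul, mul_smul_comm]
      simp [(Fin.succ_ne_zero i).symm]
  have h2 : f (fun l => Function.update v i (c • x) l.castSucc)
        * Function.update v i (c • x) (Fin.last n)
      = c • (f (fun l => Function.update v i x l.castSucc)
        * Function.update v i x (Fin.last n)) := by
    refine Fin.lastCases ?_ (fun i => ?_) i
    · simp [Fin.castSucc_ne_last]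
    · simp only [init_update, MultilinearMap.map_update_smul, smul_mul_assoc]
      simp [(Fin.castSucc_ne_last i).symm]
  simp only [diffFun, h0, h1, h2, smul_add, Finset.smul_sum]
  simp only [smul_comm c]

/-- The Hochschild differential on cochains of internal degree `d`. -/
def diff (𝒜 : ℤ → Submodule k A) [GradedAlgebra 𝒜] (d : ℤ) (n : ℕ) :
    Cochain k A n →ₗ[k] Cochain k A (n + 1) where
  toFun f := MultilinearMap.mk' (diffFun 𝒜 d f) (diffFun_update_add 𝒜 d f)
    (diffFun_update_smul 𝒜 d f)
  map_add' f f' := by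
    ext v
    simp only [diffFun, MultilinearMap.mk'_apply, _root_.add_apply, mul_add, add_mul,
      smul_add, Finset.sum_add_distrib]
    abel
  map_smul' c f := by
    ext v
    simp only [diffFun, MultilinearMap.mk'_apply, _root_.smul_apply, mul_smul_comm,
      smul_mul_assoc, smul_add, Finset.smul_sum, RingHom.id_apply, smul_comm c]

/-- Hochschild `n`-cochains of internal degree `d`: they map `𝒜 p₁ × ⋯ × 𝒜 pₙ` into
`𝒜 (p₁ + ⋯ + pₙ + d)`. -/
def cochains (𝒜 : ℤ → Submodule k A) (d : ℤ) (n : ℕ) : Submodule k (Cochain k A n) where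
  carrier := {f | ∀ (p : Fin n → ℤ) (v : Fin n → A), (∀ i, v i ∈ 𝒜 (p i)) →
    f v ∈ 𝒜 (∑ i, p i + d)}
  zero_mem' := fun p v _ => by simp
  add_mem' := fun hf hf' p v hv => Submodule.add_mem _ (hf p v hv) (hf' p v hv)
  smul_mem' := fun c _ hf p v hv => Submodule.smul_mem _ c (hf p v hv)

/-- For a subalgebra `S` (concentrated in degree `0`), the condition that a cochain is
`S`-relative, i.e. a map of `S`-bimodules `A ⊗_S ⋯ ⊗_S A → A`. -/
def IsRelative (S : Subalgebra k A) : (n : ℕ) → Cochain k A n → Prop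
  | 0, f => ∀ s ∈ S, ∀ v, s * f v = f v * s
  | n + 1, f => ∀ s ∈ S, ∀ v : Fin (n + 1) → A,
      f (Function.update v 0 (s * v 0)) = s * f v ∧
      f (Function.update v (Fin.last n) (v (Fin.last n) * s)) = f v * s ∧
      ∀ j : Fin n, f (Function.update v j.castSucc (v j.castSucc * s))
        = f (Function.update v j.succ (s * v j.succ))

/-- The condition that a cochain vanishes as soon as one of its arguments lies in `S`. -/
def IsNormalized (S : Subalgebra k A) {n : ℕ} (f : Cochain k A n) : Prop :=
  ∀ (v : Fin n → A) (i : Fin n), v i ∈ S → f v = 0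

/-- The normalized `S`-relative Hochschild cochains of internal degree `d`, i.e. maps of
`S`-bimodules `(A/S) ⊗_S ⋯ ⊗_S (A/S) → A` of degree `d`. -/
def relCochains (𝒜 : ℤ → Submodule k A) (S : Subalgebra k A) (d : ℤ) (n : ℕ) :
    Submodule k (Cochain k A n) where
  carrier := {f | f ∈ cochains 𝒜 d n ∧ IsRelative S n f ∧ IsNormalized S f}
  zero_mem' := by
    refine ⟨Submodule.zero_mem _, ?_, fun v i _ => by simp⟩
    cases n <;> simp [IsRelative]
  add_mem' := by
    rintro f f' ⟨h1, h2, h3⟩ ⟨h1', h2', h3'⟩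
    refine ⟨Submodule.add_mem _ h1 h1', ?_, fun v i hv => by simp [h3 v i hv, h3' v i hv]⟩
    cases n with
    | zero => intro s hs v; simp [mul_add, add_mul, h2 s hs v, h2' s hs v]
    | succ n =>
      intro s hs v
      obtain ⟨a, b, c⟩ := h2 s hs v
      obtain ⟨a', b', c'⟩ := h2' s hs v
      exact ⟨by simp [a, a', mul_add], by simp [b, b', add_mul], fun j => by simp [c j, c' j]⟩
  smul_mem' := by
    rintro r f ⟨h1, h2, h3⟩
    refine ⟨Submodule.smul_mem _ r h1, ?_, fun v i hv => by simp [h3 v i hv]⟩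
    cases n with
    | zero => intro s hs v; simp [h2 s hs v]
    | succ n =>
      intro s hs v
      obtain ⟨a, b, c⟩ := h2 s hs v
      exact ⟨by simp [a], by simp [b], fun j => by simp [c j]⟩

/-- The `n`-cocycles of a subcomplex `C` of the Hochschild complex (internal degree `d`). -/
def cocycles (𝒜 : ℤ → Submodule k A) [GradedAlgebra 𝒜] (d : ℤ)
    (C : (n : ℕ) → Submodule k (Cochain k A n)) (n : ℕ) : Submodule k (Cochain k A n) :=
  C n ⊓ LinearMap.ker (diff 𝒜 d n)

/-- The `n`-coboundaries of a subcomplex `C` of the Hochschild complex (internal degree `d`). -/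
def coboundaries (𝒜 : ℤ → Submodule k A) [GradedAlgebra 𝒜] (d : ℤ)
    (C : (n : ℕ) → Submodule k (Cochain k A n)) : (n : ℕ) → Submodule k (Cochain k A n)
  | 0 => ⊥
  | n + 1 => (C n).map (diff 𝒜 d n)

/-- The `n`-th cohomology (cocycles modulo coboundaries) of a subcomplex `C` of the Hochschild
complex (internal degree `d`). -/
abbrev Cohomology (𝒜 : ℤ → Submodule k A) [GradedAlgebra 𝒜] (d : ℤ)
    (C : (n : ℕ) → Submodule k (Cochain k A n)) (n : ℕ) : Type _ :=
  cocycles 𝒜 d C n ⧸ (coboundaries 𝒜 d C n).submoduleOf (cocycles 𝒜 d C n)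

/-- `HHⁿ(A)_d`, the component of internal degree `d` of the `n`-th Hochschild cohomology of the
graded `k`-algebra `A`. -/
abbrev HH (𝒜 : ℤ → Submodule k A) [GradedAlgebra 𝒜] (n : ℕ) (d : ℤ) : Type _ :=
  Cohomology 𝒜 d (cochains 𝒜 d) n

/-- `HHⁿ(A)_d` computed by the complex of normalized `S`-relative cochains. -/
abbrev RelHH (𝒜 : ℤ → Submodule k A) [GradedAlgebra 𝒜] (S : Subalgebra k A) (n : ℕ) (d : ℤ) :
    Type _ :=
  Cohomology 𝒜 d (relCochains 𝒜 S d) n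

end Graded

end Hochschild

namespace Egg

/-- Labels of the basis elements of `E_{g,g}`: the idempotents `e_O` and `e_{p_i}`, and the
elements `A_i`, `B_i`, `X_i`, `Y_i`, where `i` runs through `g` values. -/
inductive Idx (g : ℕ) : Type
  | eO : Idx g
  | eP : Fin g → Idx g
  | A : Fin g → Idx g
  | B : Fin g → Idx g
  | X : Fin g → Idx g
  | Y : Fin g → Idx g
  deriving DecidableEq

/-- The degrees of the basis elements. -/
def Idx.deg {g : ℕ} : Idx g → ℤ
  | eO => 0
  | eP _ => 0
  | A _ => 0
  | B _ => 1
  | X _ => 1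
  | Y _ => 1

/-- The algebra `E_{g,g}` over `k`: elements are families of coordinates in the basis. -/
def E (k : Type*) (g : ℕ) : Type _ := Idx g → k

variable {k : Type*} [Field k] {g : ℕ}

instance : AddCommGroup (E k g) := inferInstanceAs (AddCommGroup (Idx g → k))

instance : Module k (E k g) := inferInstanceAs (Module k (Idx g → k))

@[ext] theorem E.ext {k : Type*} {g : ℕ} {x y : E k g} (h : ∀ a, x a = y a) : x = y := funext h

@[simp] theorem add_coord (x y : E k g) (a : Idx g) : (x + y) a = x a + y a := rfl

@[simp] theorem zero_coord (a : Idx g) : (0 : E k g) a = 0 := rfl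

@[simp] theorem smul_coord (c : k) (x : E k g) (a : Idx g) : (c • x) a = c * x a := rfl

/-- The product of `E_{g,g}` in coordinates. The nonzero products of basis elements are those with
the idempotents, where `A_i = e_{p_i} A_i e_O`, `B_i = e_O B_i e_{p_i}`, `X_i = e_O X_i e_O` and
`Y_i = e_{p_i} Y_i e_{p_i}`, and the products `A_i B_i = Y_i` and `B_i A_i = X_i`. -/
def mulFun (x y : E k g) : E k g
  | .eO => x .eO * y .eO
  | .eP i => x (.eP i) * y (.eP i)
  | .A i => x (.eP i) * y (.A i) + x (.A i) * y .eO
  | .B i => x .eO * y (.B i) + x (.B i) * y (.eP i)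
  | .X i => x .eO * y (.X i) + x (.X i) * y .eO + x (.B i) * y (.A i)
  | .Y i => x (.eP i) * y (.Y i) + x (.Y i) * y (.eP i) + x (.A i) * y (.B i)

/-- The unit `e_O + ∑ᵢ e_{p_i}`. -/
def oneFun : E k g
  | .eO => 1
  | .eP _ => 1
  | _ => 0

instance : Ring (E k g) :=
  { (inferInstance : AddCommGroup (E k g)) with
    mul := mulFun
    one := oneFun
    mul_assoc := fun x y z => by
      ext a; cases a <;> change mulFun (mulFun x y) z _ = mulFun x (mulFun y z) _ <;>
        simp only [mulFun] <;> ring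
    one_mul := fun x => by
      ext a; cases a <;> change mulFun oneFun x _ = _ <;> simp [mulFun, oneFun]
    mul_one := fun x => by
      ext a; cases a <;> change mulFun x oneFun _ = _ <;> simp [mulFun, oneFun]
    left_distrib := fun x y z => by
      ext a; cases a <;> change mulFun x (y + z) _ = mulFun x y _ + mulFun x z _ <;>
        simp only [mulFun, add_coord] <;> ring
    right_distrib := fun x y z => by
      ext a; cases a <;> change mulFun (x + y) z _ = mulFun x z _ + mulFun y z _ <;>
        simp only [mulFun, add_coord] <;> ring
    zero_mul := fun x => by
      ext a; cases a <;> change mulFun 0 x _ = _ <;> simp [mulFun]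
    mul_zero := fun x => by
      ext a; cases a <;> change mulFun x 0 _ = _ <;> simp [mulFun] }

theorem mul_def (x y : E k g) : x * y = mulFun x y := rfl

instance : Algebra k (E k g) :=
  Algebra.ofModule
    (fun c x y => by ext a; cases a <;> simp only [mul_def, mulFun, smul_coord] <;> ring)
    (fun c x y => by ext a; cases a <;> simp only [mul_def, mulFun, smul_coord] <;> ring)

/-- The basis element with a given label. -/
def b (k : Type*) [Field k] {g : ℕ} (a : Idx g) : E k g := fun a' => if a' = a then 1 else 0

/-- The grading of `E_{g,g}`: the elements of degree `d` are the combinations of basis elements of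
degree `d`. -/
def grading (k : Type*) [Field k] (g : ℕ) (d : ℤ) : Submodule k (E k g) where
  carrier := {x | ∀ a, a.deg ≠ d → x a = 0}
  zero_mem' := fun _ _ => rfl
  add_mem' := fun hx hy a ha => by simp [hx a ha, hy a ha]
  smul_mem' := fun c x hx a ha => by simp [hx a ha]

/-- The projection to the degree `d` component. -/
def gradProj (k : Type*) [Field k] (g : ℕ) (d : ℤ) : E k g →ₗ[k] grading k g d where
  toFun x := ⟨fun a => if a.deg = d then x a else 0, fun a ha => if_neg ha⟩
  map_add' x y := by
    apply Subtype.ext; ext a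
    change (if a.deg = d then (x + y) a else 0)
      = (if a.deg = d then x a else 0) + (if a.deg = d then y a else 0)
    split_ifs <;> simp
  map_smul' c x := by
    apply Subtype.ext; ext a
    change (if a.deg = d then (c • x) a else 0) = c * (if a.deg = d then x a else 0)
    split_ifs <;> simp

theorem gradProj_apply (d : ℤ) (x : E k g) (a : Idx g) :
    (gradProj k g d x : E k g) a = if a.deg = d then x a else 0 := rfl

instance : SetLike.GradedMonoid (grading k g) where
  one_mem := by
    intro a ha
    change oneFun a = 0
    cases a <;> simp_all [Idx.deg, oneFun]
  mul_mem := by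
    intro i j x y hx hy a ha
    have key : ∀ a₁ a₂ : Idx g, a₁.deg + a₂.deg = a.deg → x a₁ * y a₂ = 0 := by
      intro a₁ a₂ h
      by_cases h1 : a₁.deg = i
      · rw [hy a₂ (fun h2 => ha (by rw [← h, h1, h2])), mul_zero]
      · rw [hx a₁ h1, zero_mul]
    rw [mul_def]
    cases a <;> simp only [mulFun] <;> repeat' (first | rw [key _ _ rfl] | simp only [add_zero])

instance : DirectSum.Decomposition (grading k g) :=
  DirectSum.Decomposition.ofLinearMap (grading k g)
    (DirectSum.lof k ℤ (fun d => grading k g d) 0 ∘ₗ gradProj k g 0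
      + DirectSum.lof k ℤ (fun d => grading k g d) 1 ∘ₗ gradProj k g 1)
    (by
      ext x a
      simp only [LinearMap.comp_apply, LinearMap.add_apply, map_add, LinearMap.id_apply,
        DirectSum.coeLinearMap_lof, add_coord, gradProj_apply]
      cases a <;> simp [Idx.deg])
    (by
      refine DirectSum.linearMap_ext k fun d => LinearMap.ext fun x => ?_
      have h1 : ∀ e : ℤ, e ≠ d → gradProj k g e (x : E k g) = 0 := by
        intro e he
        apply Subtype.ext
        ext a
        rw [gradProj_apply]
        split_ifs with h
        · exact x.2 a (h ▸ he)
        · rfl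
      have h2 : gradProj k g d (x : E k g) = x := by
        apply Subtype.ext
        ext a
        rw [gradProj_apply]
        split_ifs with h
        · rfl
        · exact (x.2 a h).symm
      simp only [LinearMap.comp_apply, LinearMap.add_apply, DirectSum.coeLinearMap_lof,
        LinearMap.id_apply]
      by_cases hd0 : d = 0
      · subst hd0
        rw [h2, h1 1 (by norm_num), map_zero, add_zero]
      · by_cases hd1 : d = 1
        · subst hd1
          rw [h2, h1 0 (by norm_num), map_zero, zero_add]
        · have hx : x = 0 := by
            apply Subtype.ext
            ext a
            exact x.2 a (by cases a <;> simp [Idx.deg, Ne.symm hd0, Ne.symm hd1])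
          simp [hx])

instance : GradedAlgebra (grading k g) where

/-- The subalgebra `R` of `E_{g,g}` spanned by the idempotents `e_O` and `e_{p_i}`. -/
def idempotents (k : Type*) [Field k] (g : ℕ) : Subalgebra k (E k g) :=
  Algebra.adjoin k (insert (b k .eO) (Set.range fun i : Fin g => b k (.eP i)))

/-- The constant `α_{ij}(c)`: the coefficient of `X_j` in `c(B_i, Y_i, A_i)`. -/
def alpha (c : Hochschild.Cochain k (E k g) 3) (i j : Fin g) : k :=
  (c ![b k (.B i), b k (.Y i), b k (.A i)] : E k g) (.X j)

/-- The space of `g × g` matrices with zero diagonal. -/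
def zeroDiag (k : Type*) [Field k] (g : ℕ) : Submodule k (Matrix (Fin g) (Fin g) k) where
  carrier := {M | ∀ i, M i i = 0}
  zero_mem' := fun _ => rfl
  add_mem' := fun hM hN i => by simp [hM i, hN i]
  smul_mem' := fun c M hM i => by simp [hM i]

end Egg

end

/-! The off-diagonal `α_{ij}` are invariants of the class. Since `B_i Y_i = 0 = Y_i A_i`, the value
of `δf` at `(B_i, Y_i, A_i)` is `-B_i f(Y_i, A_i) - f(B_i, Y_i) A_i`, and the only `X`-component of
an element of `B_i E + E A_i` is along `X_i`. They are also arbitrary: for any matrix `M`, sending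
both `(B_i, Y_i, A_i)` and `(B_i, A_i, X_i)` to `∑_l M_{il} X_l` defines a relative cocycle
(`ternaryCochain_mem`).

Injectivity remains: a cocycle whose off-diagonal `α_{ij}` vanish is a coboundary. In the full
complex, averaging over the idempotents, one argument at a time, replaces a cocycle by a
cohomologous normalized one (`exists_sub_diff_mem_relCocycles`), and a normalized cocycle is
automatically `R`-bilinear. This does not affect the invariants.

For a normalized relative cochain of degree `-1`, the arguments must form a path in the two-way
quiver joining `O` to the `p_i`, the output must be parallel to that path, and the degrees must
match. Only eight families of structure constants survive (`idx_cases`). An explicit binary cochain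
with parameters `u, r, z, v, s, t` removes six of them, given that the off-diagonal `α_{ij}` vanish;
solving for `u` requires division by `2`. The cocycle identity at `(A_i, B_j, A_j, B_i)` and at
`(B_i, A_i, B_j, A_j)` then forces the remaining two families to vanish
(`exists_diff_eq_of_alpha_eq_zero`). -/

namespace Hochschild

/-! ### The Hochschild complex in degrees two and three -/

section General

variable {k : Type*} [Field k] {A : Type*} [Ring A] [Algebra k A]

theorem koszulTwist_of_mem_zero (𝒜 : ℤ → Submodule k A) [GradedAlgebra 𝒜] (d : ℤ) {a : A}
    (ha : a ∈ 𝒜 0) : koszulTwist 𝒜 d a = a := by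
  simp [koszulTwist_of_mem 𝒜 d ha]

theorem koszulTwist_mem (𝒜 : ℤ → Submodule k A) [GradedAlgebra 𝒜] (d : ℤ) {i : ℤ} {a : A}
    (ha : a ∈ 𝒜 i) : koszulTwist 𝒜 d a ∈ 𝒜 i := by
  rw [koszulTwist_of_mem 𝒜 d ha]
  exact zsmul_mem ha _

/-- The sign `(-1) ^ (d * i)` is additive in the exponent `i`, and degrees add under products. This
is what lets the signed differential square to zero. -/
theorem koszulTwist_mul (𝒜 : ℤ → Submodule k A) [GradedAlgebra 𝒜] (d : ℤ) (a b : A) :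
    koszulTwist 𝒜 d (a * b) = koszulTwist 𝒜 d a * koszulTwist 𝒜 d b := by
  induction a using DirectSum.Decomposition.inductionOn 𝒜 with
  | zero => simp
  | add a a' ha ha' => simp [add_mul, ha, ha']
  | @homogeneous i a =>
    induction b using DirectSum.Decomposition.inductionOn 𝒜 with
    | zero => simp
    | add b b' hb hb' => simp [mul_add, hb, hb']
    | @homogeneous j b =>
      rw [koszulTwist_of_mem 𝒜 d a.2, koszulTwist_of_mem 𝒜 d b.2,
        koszulTwist_of_mem 𝒜 d (SetLike.mul_mem_graded a.2 b.2), mul_add, Int.negOnePow_add,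
        smul_mul_smul_comm]
      simp

theorem vec_two_eta {A : Type*} (v : Fin 2 → A) : ![v 0, v 1] = v := by
  ext i; fin_cases i <;> rfl

theorem vec_three_eta {A : Type*} (v : Fin 3 → A) : ![v 0, v 1, v 2] = v := by
  ext i; fin_cases i <;> rfl

theorem vec_four_eta {A : Type*} (v : Fin 4 → A) : ![v 0, v 1, v 2, v 3] = v := by
  ext i; fin_cases i <;> rfl

theorem Cochain.ext_three {f f' : Cochain k A 3} (h : ∀ x y z, f ![x, y, z] = f' ![x, y, z]) :
    f = f' := by
  ext v
  rw [← vec_three_eta v]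
  exact h _ _ _

theorem Cochain.ext_four {f f' : Cochain k A 4}
    (h : ∀ x y z w, f ![x, y, z, w] = f' ![x, y, z, w]) : f = f' := by
  ext v
  rw [← vec_four_eta v]
  exact h _ _ _ _

theorem update_vec_two_zero {A : Type*} (x y t : A) : Function.update ![x, y] 0 t = ![t, y] := by
  ext i; fin_cases i <;> rfl

theorem update_vec_two_one {A : Type*} (x y t : A) : Function.update ![x, y] 1 t = ![x, t] := by
  ext i; fin_cases i <;> rfl

theorem update_vec_three_zero {A : Type*} (x y z t : A) :
    Function.update ![x, y, z] 0 t = ![t, y, z] := by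
  ext i; fin_cases i <;> rfl

theorem update_vec_three_one {A : Type*} (x y z t : A) :
    Function.update ![x, y, z] 1 t = ![x, t, z] := by
  ext i; fin_cases i <;> rfl

theorem update_vec_three_two {A : Type*} (x y z t : A) :
    Function.update ![x, y, z] 2 t = ![x, y, t] := by
  ext i; fin_cases i <;> rfl

/-- A ternary cochain is linear in its first argument. -/
def slotOne (c : Cochain k A 3) (y z : A) : A →ₗ[k] A :=
  c.toLinearMap ![0, y, z] 0

theorem slotOne_apply (c : Cochain k A 3) (x y z : A) : slotOne c y z x = c ![x, y, z] := by
  simp [slotOne, MultilinearMap.toLinearMap_apply, update_vec_three_zero]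

/-- A ternary cochain is linear in its second argument. -/
def slotTwo (c : Cochain k A 3) (x z : A) : A →ₗ[k] A :=
  c.toLinearMap ![x, 0, z] 1

theorem slotTwo_apply (c : Cochain k A 3) (x y z : A) : slotTwo c x z y = c ![x, y, z] := by
  simp [slotTwo, MultilinearMap.toLinearMap_apply, update_vec_three_one]

/-- A ternary cochain is linear in its third argument. -/
def slotThree (c : Cochain k A 3) (x y : A) : A →ₗ[k] A :=
  c.toLinearMap ![x, y, 0] 2

theorem slotThree_apply (c : Cochain k A 3) (x y z : A) : slotThree c x y z = c ![x, y, z] := by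
  simp [slotThree, MultilinearMap.toLinearMap_apply, update_vec_three_two]

/-- The binary cochain of a bilinear map. -/
def ofBilin (F : A →ₗ[k] A →ₗ[k] A) : Cochain k A 2 :=
  MultilinearMap.mk' (fun v => F (v 0) (v 1))
    (fun v i x y => by fin_cases i <;> simp)
    (fun v i c x => by fin_cases i <;> simp)

theorem diff_two_apply (𝒜 : ℤ → Submodule k A) [GradedAlgebra 𝒜] (d : ℤ) (f : Cochain k A 2)
    (x y z : A) : diff 𝒜 d 2 f ![x, y, z]
      = koszulTwist 𝒜 d x * f ![y, z] - f ![x * y, z] + f ![x, y * z] - f ![x, y] * z := by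
  have h0 : merge (0 : Fin 2) ![x, y, z] = ![x * y, z] := by ext i; fin_cases i <;> rfl
  have h1 : merge (1 : Fin 2) ![x, y, z] = ![x, y * z] := by ext i; fin_cases i <;> rfl
  have h2 : (fun i : Fin 2 => ![x, y, z] i.succ) = ![y, z] := by ext i; fin_cases i <;> rfl
  have h3 : (fun i : Fin 2 => ![x, y, z] i.castSucc) = ![x, y] := by ext i; fin_cases i <;> rfl
  change diffFun 𝒜 d f ![x, y, z] = _
  simp only [diffFun, Fin.sum_univ_two, h0, h1, h2, h3]
  change koszulTwist 𝒜 d x * f ![y, z] + ((-1 : ℤ) ^ (0 + 1) • f ![x * y, z]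
    + (-1 : ℤ) ^ (1 + 1) • f ![x, y * z]) + (-1 : ℤ) ^ (2 + 1) • (f ![x, y] * z) = _
  norm_num
  abel

theorem diff_three_apply (𝒜 : ℤ → Submodule k A) [GradedAlgebra 𝒜] (d : ℤ) (f : Cochain k A 3)
    (x y z w : A) : diff 𝒜 d 3 f ![x, y, z, w]
      = koszulTwist 𝒜 d x * f ![y, z, w] - f ![x * y, z, w] + f ![x, y * z, w]
        - f ![x, y, z * w] + f ![x, y, z] * w := by
  have h0 : merge (0 : Fin 3) ![x, y, z, w] = ![x * y, z, w] := by ext i; fin_cases i <;> rfl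
  have h1 : merge (1 : Fin 3) ![x, y, z, w] = ![x, y * z, w] := by ext i; fin_cases i <;> rfl
  have h2 : merge (2 : Fin 3) ![x, y, z, w] = ![x, y, z * w] := by ext i; fin_cases i <;> rfl
  have h3 : (fun i : Fin 3 => ![x, y, z, w] i.succ) = ![y, z, w] := by
    ext i; fin_cases i <;> rfl
  have h4 : (fun i : Fin 3 => ![x, y, z, w] i.castSucc) = ![x, y, z] := by
    ext i; fin_cases i <;> rfl
  change diffFun 𝒜 d f ![x, y, z, w] = _
  simp only [diffFun, Fin.sum_univ_three, h0, h1, h2, h3, h4]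
  change koszulTwist 𝒜 d x * f ![y, z, w] + ((-1 : ℤ) ^ (0 + 1) • f ![x * y, z, w]
    + (-1 : ℤ) ^ (1 + 1) • f ![x, y * z, w] + (-1 : ℤ) ^ (2 + 1) • f ![x, y, z * w])
    + (-1 : ℤ) ^ (3 + 1) • (f ![x, y, z] * w) = _
  norm_num
  abel

theorem diff_diff_two (𝒜 : ℤ → Submodule k A) [GradedAlgebra 𝒜] (d : ℤ) (f : Cochain k A 2) :
    diff 𝒜 d 3 (diff 𝒜 d 2 f) = 0 := by
  refine Cochain.ext_four fun x y z w => ?_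
  simp only [diff_three_apply, diff_two_apply, koszulTwist_mul, _root_.zero_apply,
    mul_assoc]
  noncomm_ring

theorem mem_cochains_two {𝒜 : ℤ → Submodule k A} {d : ℤ} {f : Cochain k A 2} :
    f ∈ cochains 𝒜 d 2 ↔ ∀ p q x y, x ∈ 𝒜 p → y ∈ 𝒜 q → f ![x, y] ∈ 𝒜 (p + q + d) := by
  refine ⟨fun h p q x y hx hy => ?_, fun h p v hv => ?_⟩
  · have := h ![p, q] ![x, y] (by intro i; fin_cases i <;> assumption)
    simpa [Fin.sum_univ_two] using this
  · rw [← vec_two_eta v, Fin.sum_univ_two]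
    exact h _ _ _ _ (hv 0) (hv 1)

theorem mem_cochains_three {𝒜 : ℤ → Submodule k A} {d : ℤ} {f : Cochain k A 3} :
    f ∈ cochains 𝒜 d 3 ↔ ∀ p q r x y z, x ∈ 𝒜 p → y ∈ 𝒜 q → z ∈ 𝒜 r →
      f ![x, y, z] ∈ 𝒜 (p + q + r + d) := by
  refine ⟨fun h p q r x y z hx hy hz => ?_, fun h p v hv => ?_⟩
  · have := h ![p, q, r] ![x, y, z] (by intro i; fin_cases i <;> assumption)
    simpa [Fin.sum_univ_three] using this
  · rw [← vec_three_eta v, Fin.sum_univ_three]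
    exact h _ _ _ _ _ _ (hv 0) (hv 1) (hv 2)

theorem diff_two_mem_cochains {𝒜 : ℤ → Submodule k A} [GradedAlgebra 𝒜] {d : ℤ}
    {f : Cochain k A 2} (hf : f ∈ cochains 𝒜 d 2) : diff 𝒜 d 2 f ∈ cochains 𝒜 d 3 := by
  rw [mem_cochains_two] at hf
  rw [mem_cochains_three]
  intro p q r x y z hx hy hz
  rw [diff_two_apply]
  refine sub_mem (add_mem (sub_mem ?_ ?_) ?_) ?_
  · convert SetLike.mul_mem_graded (koszulTwist_mem 𝒜 d hx) (hf _ _ _ _ hy hz) using 2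
    ring
  · exact hf _ _ _ _ (SetLike.mul_mem_graded hx hy) hz
  · convert hf _ _ _ _ hx (SetLike.mul_mem_graded hy hz) using 2
    ring
  · convert SetLike.mul_mem_graded (hf _ _ _ _ hx hy) hz using 2
    ring

theorem isRelative_two_iff {S : Subalgebra k A} {f : Cochain k A 2} :
    IsRelative S 2 f ↔ ∀ s ∈ S, ∀ x y, f ![s * x, y] = s * f ![x, y] ∧
      f ![x, y * s] = f ![x, y] * s ∧ f ![x * s, y] = f ![x, s * y] := by
  refine ⟨fun h s hs x y => ?_, fun h s hs v => ?_⟩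
  · obtain ⟨h0, h1, h2⟩ := h s hs ![x, y]
    have h2 := h2 0
    refine ⟨?_, ?_, ?_⟩
    · rw [← update_vec_two_zero x y]; exact h0
    · rw [← update_vec_two_one x y]; exact h1
    · rw [← update_vec_two_one x y, ← update_vec_two_zero x y]; exact h2
  · obtain ⟨h0, h1, h2⟩ := h s hs (v 0) (v 1)
    rw [← vec_two_eta v]
    refine ⟨?_, ?_, fun j => ?_⟩
    · rw [update_vec_two_zero]; exact h0
    · change f (Function.update ![v 0, v 1] 1 _) = _
      rw [update_vec_two_one]; exact h1
    · fin_cases j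
      change f (Function.update ![v 0, v 1] 0 _) = f (Function.update ![v 0, v 1] 1 _)
      rw [update_vec_two_zero, update_vec_two_one]; exact h2

theorem isRelative_three_iff {S : Subalgebra k A} {f : Cochain k A 3} :
    IsRelative S 3 f ↔ ∀ s ∈ S, ∀ x y z, f ![s * x, y, z] = s * f ![x, y, z] ∧
      f ![x, y, z * s] = f ![x, y, z] * s ∧ f ![x * s, y, z] = f ![x, s * y, z] ∧
      f ![x, y * s, z] = f ![x, y, s * z] := by
  refine ⟨fun h s hs x y z => ?_, fun h s hs v => ?_⟩
  · obtain ⟨h0, h1, h2⟩ := h s hs ![x, y, z]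
    have h3 := h2 1
    have h2 := h2 0
    refine ⟨?_, ?_, ?_, ?_⟩
    · rw [← update_vec_three_zero x y z]; exact h0
    · rw [← update_vec_three_two x y z]; exact h1
    · rw [← update_vec_three_one x y z, ← update_vec_three_zero x y z]; exact h2
    · rw [← update_vec_three_two x y z, ← update_vec_three_one x y z]; exact h3
  · obtain ⟨h0, h1, h2, h3⟩ := h s hs (v 0) (v 1) (v 2)
    rw [← vec_three_eta v]
    refine ⟨?_, ?_, fun j => ?_⟩
    · rw [update_vec_three_zero]; exact h0
    · change f (Function.update ![v 0, v 1, v 2] 2 _) = _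
      rw [update_vec_three_two]; exact h1
    · fin_cases j
      · change f (Function.update ![v 0, v 1, v 2] 0 _) = f (Function.update ![v 0, v 1, v 2] 1 _)
        rw [update_vec_three_zero, update_vec_three_one]; exact h2
      · change f (Function.update ![v 0, v 1, v 2] 1 _) = f (Function.update ![v 0, v 1, v 2] 2 _)
        rw [update_vec_three_one, update_vec_three_two]; exact h3

theorem isNormalized_two_iff {S : Subalgebra k A} {f : Cochain k A 2} :
    IsNormalized S f ↔ ∀ s ∈ S, ∀ x, f ![s, x] = 0 ∧ f ![x, s] = 0 := by
  refine ⟨fun h s hs x => ⟨h _ 0 hs, h _ 1 hs⟩, fun h v i hv => ?_⟩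
  rw [← vec_two_eta v]
  fin_cases i
  · exact (h _ hv _).1
  · exact (h _ hv _).2

theorem isNormalized_three_iff {S : Subalgebra k A} {f : Cochain k A 3} :
    IsNormalized S f ↔ ∀ s ∈ S, ∀ x y,
      f ![s, x, y] = 0 ∧ f ![x, s, y] = 0 ∧ f ![x, y, s] = 0 := by
  refine ⟨fun h s hs x y => ⟨h _ 0 hs, h _ 1 hs, h _ 2 hs⟩, fun h v i hv => ?_⟩
  rw [← vec_three_eta v]
  fin_cases i
  · exact (h _ hv _ _).1
  · exact (h _ hv _ _).2.1
  · exact (h _ hv _ _).2.2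

/-- An element of `S` has degree `0`, so it passes through the Koszul twist without a sign. In each
slot the terms of the differential then either transform alike or cancel in pairs. -/
theorem diff_two_mem_relCochains {𝒜 : ℤ → Submodule k A} [GradedAlgebra 𝒜] {d : ℤ}
    {S : Subalgebra k A} (hS : ∀ s ∈ S, s ∈ 𝒜 0) {f : Cochain k A 2}
    (hf : f ∈ relCochains 𝒜 S d 2) : diff 𝒜 d 2 f ∈ relCochains 𝒜 S d 3 := by
  obtain ⟨h1, h2, h3⟩ := hf
  rw [isRelative_two_iff] at h2
  rw [isNormalized_two_iff] at h3
  refine ⟨diff_two_mem_cochains h1, ?_, ?_⟩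
  · rw [isRelative_three_iff]
    intro s hs x y z
    have hτ := koszulTwist_of_mem_zero 𝒜 d (hS s hs)
    have e1 : ∀ x y, f ![s * x, y] = s * f ![x, y] := fun x y => (h2 s hs x y).1
    have e2 : ∀ x y, f ![x, y * s] = f ![x, y] * s := fun x y => (h2 s hs x y).2.1
    have e3 : ∀ x y, f ![x * s, y] = f ![x, s * y] := fun x y => (h2 s hs x y).2.2
    simp only [diff_two_apply, koszulTwist_mul, hτ]
    refine ⟨?_, ?_, ?_, ?_⟩
    · simp only [mul_assoc, e1]; noncomm_ring
    · simp only [← mul_assoc, e2]; noncomm_ring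
    · simp only [mul_assoc, e1, e3]
    · simp only [← mul_assoc, e2, e3]
  · rw [isNormalized_three_iff]
    intro s hs x y
    have hτ := koszulTwist_of_mem_zero 𝒜 d (hS s hs)
    have n1 := fun x => (h3 s hs x).1
    have n2 := fun x => (h3 s hs x).2
    have e1 : ∀ x y, f ![s * x, y] = s * f ![x, y] := fun x y => (h2 s hs x y).1
    have e2 : ∀ x y, f ![x, y * s] = f ![x, y] * s := fun x y => (h2 s hs x y).2.1
    have e3 : ∀ x y, f ![x * s, y] = f ![x, s * y] := fun x y => (h2 s hs x y).2.2
    simp [diff_two_apply, hτ, n1, n2, e1, e2, e3]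

/-- A normalized cocycle is relative. -/
theorem isRelative_of_isNormalized {𝒜 : ℤ → Submodule k A} [GradedAlgebra 𝒜] {d : ℤ}
    {S : Subalgebra k A} (hS : ∀ s ∈ S, s ∈ 𝒜 0) {c : Cochain k A 3} (hc : diff 𝒜 d 3 c = 0)
    (hn : IsNormalized S c) : IsRelative S 3 c := by
  rw [isNormalized_three_iff] at hn
  have hc : ∀ x y z w, koszulTwist 𝒜 d x * c ![y, z, w] - c ![x * y, z, w] + c ![x, y * z, w]
      - c ![x, y, z * w] + c ![x, y, z] * w = 0 := fun x y z w => by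
    rw [← diff_three_apply, hc]; rfl
  rw [isRelative_three_iff]
  intro s hs x y z
  have n1 := fun x y => (hn s hs x y).1
  have n2 := fun x y => (hn s hs x y).2.1
  have n3 := fun x y => (hn s hs x y).2.2
  have hτ := koszulTwist_of_mem_zero 𝒜 d (hS s hs)
  -- With `s` in any of the four positions, every term that has `s` alone as an argument vanishes.
  -- The two surviving terms express linearity or balancing over `s` at that position.
  have c1 := hc s x y z
  have c2 := hc x s y z
  have c3 := hc x y s z
  have c4 := hc x y z s
  simp only [hτ, n1, n2, n3, mul_zero, zero_mul, sub_zero, add_zero, zero_sub, zero_add] at c1 c2 c3 c4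
  refine ⟨(sub_eq_zero.1 c1).symm, ?_, ?_, ?_⟩
  · rw [neg_add_eq_zero] at c4; exact c4
  · rw [neg_add_eq_zero] at c2; exact c2
  · exact sub_eq_zero.1 c3

end General

end Hochschild

/-! ### Normalization by averaging over orthogonal idempotents -/

namespace Hochschild

section Normalization

variable {k : Type*} [Field k] {A : Type*} [Ring A] [Algebra k A]

theorem map_add_one (c : Cochain k A 3) (x x' y z : A) :
    c ![x + x', y, z] = c ![x, y, z] + c ![x', y, z] := by
  simp only [← slotOne_apply, map_add]

theorem map_add_two (c : Cochain k A 3) (x y y' z : A) :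
    c ![x, y + y', z] = c ![x, y, z] + c ![x, y', z] := by
  simp only [← slotTwo_apply, map_add]

theorem map_add_three (c : Cochain k A 3) (x y z z' : A) :
    c ![x, y, z + z'] = c ![x, y, z] + c ![x, y, z'] := by
  simp only [← slotThree_apply, map_add]

theorem map_smul_one (c : Cochain k A 3) (r : k) (x y z : A) :
    c ![r • x, y, z] = r • c ![x, y, z] := by
  simp only [← slotOne_apply, map_smul]

theorem map_smul_two (c : Cochain k A 3) (r : k) (x y z : A) :
    c ![x, r • y, z] = r • c ![x, y, z] := by
  simp only [← slotTwo_apply, map_smul]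

theorem map_smul_three (c : Cochain k A 3) (r : k) (x y z : A) :
    c ![x, y, r • z] = r • c ![x, y, z] := by
  simp only [← slotThree_apply, map_smul]

theorem map_zero_one (c : Cochain k A 3) (y z : A) : c ![0, y, z] = 0 := by
  simp only [← slotOne_apply, map_zero]

theorem map_zero_two (c : Cochain k A 3) (x z : A) : c ![x, 0, z] = 0 := by
  simp only [← slotTwo_apply, map_zero]

theorem map_zero_three (c : Cochain k A 3) (x y : A) : c ![x, y, 0] = 0 := by
  simp only [← slotThree_apply, map_zero]

variable {ι : Type*} [Fintype ι]

/-- The average of a ternary cochain over its first argument. -/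
def averageOne (e : ι → A) (c : Cochain k A 3) : Cochain k A 2 :=
  ofBilin <| LinearMap.mk₂ k (fun y z => ∑ v, e v * c ![e v, y, z])
    (by intros; simp only [map_add_two, mul_add, Finset.sum_add_distrib])
    (by intros; simp only [map_smul_two, mul_smul_comm, Finset.smul_sum])
    (by intros; simp only [map_add_three, mul_add, Finset.sum_add_distrib])
    (by intros; simp only [map_smul_three, mul_smul_comm, Finset.smul_sum])

/-- The average of a ternary cochain over its second argument. -/
def averageTwo (e : ι → A) (c : Cochain k A 3) : Cochain k A 2 :=
  ofBilin <| LinearMap.mk₂ k (fun x z => ∑ v, c ![x * e v, e v, z])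
    (by intros; simp only [map_add_one, add_mul, Finset.sum_add_distrib])
    (by intros; simp only [map_smul_one, smul_mul_assoc, Finset.smul_sum])
    (by intros; simp only [map_add_three, Finset.sum_add_distrib])
    (by intros; simp only [map_smul_three, Finset.smul_sum])

/-- The average of a ternary cochain over its third argument. -/
def averageThree (e : ι → A) (c : Cochain k A 3) : Cochain k A 2 :=
  ofBilin <| LinearMap.mk₂ k (fun x y => ∑ v, c ![x, y * e v, e v])
    (by intros; simp only [map_add_one, Finset.sum_add_distrib])
    (by intros; simp only [map_smul_one, Finset.smul_sum])
    (by intros; simp only [map_add_two, add_mul, Finset.sum_add_distrib])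
    (by intros; simp only [map_smul_two, smul_mul_assoc, Finset.smul_sum])

theorem averageOne_apply (e : ι → A) (c : Cochain k A 3) (y z : A) :
    averageOne e c ![y, z] = ∑ v, e v * c ![e v, y, z] := rfl

theorem averageTwo_apply (e : ι → A) (c : Cochain k A 3) (x z : A) :
    averageTwo e c ![x, z] = ∑ v, c ![x * e v, e v, z] := rfl

theorem averageThree_apply (e : ι → A) (c : Cochain k A 3) (x y : A) :
    averageThree e c ![x, y] = ∑ v, c ![x, y * e v, e v] := rfl

theorem averageOne_mem {𝒜 : ℤ → Submodule k A} [GradedAlgebra 𝒜] {d : ℤ} {e : ι → A}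
    (he0 : ∀ v, e v ∈ 𝒜 0) {c : Cochain k A 3} (hc : c ∈ cochains 𝒜 d 3) :
    averageOne e c ∈ cochains 𝒜 d 2 := by
  rw [mem_cochains_two]
  rw [mem_cochains_three] at hc
  intro p q x y hx hy
  rw [averageOne_apply]
  refine sum_mem fun v _ => ?_
  convert SetLike.mul_mem_graded (he0 v) (hc _ _ _ _ _ _ (he0 v) hx hy) using 2
  ring

theorem averageTwo_mem {𝒜 : ℤ → Submodule k A} [GradedAlgebra 𝒜] {d : ℤ} {e : ι → A}
    (he0 : ∀ v, e v ∈ 𝒜 0) {c : Cochain k A 3} (hc : c ∈ cochains 𝒜 d 3) :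
    averageTwo e c ∈ cochains 𝒜 d 2 := by
  rw [mem_cochains_two]
  rw [mem_cochains_three] at hc
  intro p q x y hx hy
  rw [averageTwo_apply]
  refine sum_mem fun v _ => ?_
  convert hc _ _ _ _ _ _ (SetLike.mul_mem_graded hx (he0 v)) (he0 v) hy using 2
  ring

theorem averageThree_mem {𝒜 : ℤ → Submodule k A} [GradedAlgebra 𝒜] {d : ℤ} {e : ι → A}
    (he0 : ∀ v, e v ∈ 𝒜 0) {c : Cochain k A 3} (hc : c ∈ cochains 𝒜 d 3) :
    averageThree e c ∈ cochains 𝒜 d 2 := by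
  rw [mem_cochains_two]
  rw [mem_cochains_three] at hc
  intro p q x y hx hy
  rw [averageThree_apply]
  refine sum_mem fun v _ => ?_
  convert hc _ _ _ _ _ _ hx (SetLike.mul_mem_graded hy (he0 v)) (he0 v) using 2
  ring

theorem cocycle_identity {𝒜 : ℤ → Submodule k A} [GradedAlgebra 𝒜] {d : ℤ} {c : Cochain k A 3}
    (hc : diff 𝒜 d 3 c = 0) (x y z w : A) :
    koszulTwist 𝒜 d x * c ![y, z, w] - c ![x * y, z, w] + c ![x, y * z, w]
      - c ![x, y, z * w] + c ![x, y, z] * w = 0 := by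
  rw [← diff_three_apply, hc]; rfl

/-- In a sum over orthogonal idempotents weighted by products with `e w`, only the term at `w`
survives. -/
theorem sum_mul_idem {e : ι → A} (he : OrthogonalIdempotents e) (w : ι) (F : A → ι → A)
    (hF : ∀ v, F 0 v = 0) : ∑ v, F (e v * e w) v = F (e w) w := by
  classical
  rw [Finset.sum_eq_single w]
  · rw [he.idem w]
  · intro v _ hv
    rw [he.ortho hv, hF]
  · simp

theorem sum_idem_mul {e : ι → A} (he : OrthogonalIdempotents e) (w : ι) (F : A → ι → A)
    (hF : ∀ v, F 0 v = 0) : ∑ v, F (e w * e v) v = F (e w) w := by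
  classical
  rw [Finset.sum_eq_single w]
  · rw [he.idem w]
  · intro v _ hv
    rw [he.ortho (Ne.symm hv), hF]
  · simp

/-- `∑ v, e v ⊗ e v` is a separability idempotent for the span of the `e v`; inserting it in a slot
gives a contracting homotopy. Here it removes the values with an idempotent in the first slot. -/
theorem diff_averageOne {𝒜 : ℤ → Submodule k A} [GradedAlgebra 𝒜] {d : ℤ} {e : ι → A}
    (he : CompleteOrthogonalIdempotents e) (he0 : ∀ v, e v ∈ 𝒜 0) {c : Cochain k A 3}
    (hc : diff 𝒜 d 3 c = 0) (w : ι) (y z : A) :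
    diff 𝒜 d 2 (averageOne e c) ![e w, y, z] = c ![e w, y, z] := by
  -- The cocycle identity at `(e v, e w, y, z)`, multiplied on the left by `e v`. After summation
  -- over `v`, completeness turns the last term into `c ![e w, y, z]`.
  have key : ∀ v, e v * c ![e v, e w * y, z] - e v * c ![e v, e w, y * z]
      + e v * c ![e v, e w, y] * z = e v * c ![e v * e w, y, z] - e v * c ![e w, y, z] := by
    intro v
    have h := congrArg (e v * ·) (cocycle_identity hc (e v) (e w) y z)
    simp only [koszulTwist_of_mem_zero 𝒜 d (he0 v), mul_add, mul_sub, ← mul_assoc,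
      (he.idem v).eq, mul_zero] at h
    rw [← sub_eq_zero, ← h]
    abel
  have hs := Finset.sum_congr rfl fun v (_ : v ∈ Finset.univ) => key v
  have h1 : ∑ v, e v * c ![e v * e w, y, z] = e w * c ![e w, y, z] :=
    sum_mul_idem he.toOrthogonalIdempotents w (fun a v => e v * c ![a, y, z])
      (fun v => by simp [map_zero_one])
  have h2 : e w * ∑ v, e v * c ![e v, y, z] = e w * c ![e w, y, z] := by
    simp only [Finset.mul_sum, ← mul_assoc]
    exact sum_idem_mul he.toOrthogonalIdempotents w (fun a v => a * c ![e v, y, z])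
      (fun v => by simp)
  simp only [Finset.sum_add_distrib, Finset.sum_sub_distrib, h1, ← Finset.sum_mul, he.complete,
    one_mul] at hs
  rw [diff_two_apply, koszulTwist_of_mem_zero 𝒜 d (he0 w)]
  simp only [averageOne_apply, h2]
  rw [eq_sub_iff_add_eq] at hs
  rw [← sub_eq_zero, ← neg_eq_zero, ← sub_eq_zero.2 hs]
  abel

/-- The same homotopy in the second slot. Vanishing in the first slot makes `c` linear on the left
over the `e w`, so the correction does not disturb that slot. The sign is opposite to that of the
first and third slots. -/
theorem diff_averageTwo {𝒜 : ℤ → Submodule k A} [GradedAlgebra 𝒜] {d : ℤ} {e : ι → A}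
    (he : CompleteOrthogonalIdempotents e) (he0 : ∀ v, e v ∈ 𝒜 0) {c : Cochain k A 3}
    (hc : diff 𝒜 d 3 c = 0) (hc1 : ∀ w y z, c ![e w, y, z] = 0) (w : ι) (x y : A) :
    diff 𝒜 d 2 (averageTwo e c) ![e w, x, y] = 0 ∧
    diff 𝒜 d 2 (averageTwo e c) ![x, e w, y] = - c ![x, e w, y] := by
  have hz : ∀ y, averageTwo e c ![e w, y] = 0 := fun y => by
    rw [averageTwo_apply, sum_idem_mul he.toOrthogonalIdempotents w (fun a v => c ![a, e v, y])
      (fun v => map_zero_one _ _ _), hc1]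
  have hl : ∀ x y z, c ![e w * x, y, z] = e w * c ![x, y, z] := fun x y z => by
    have := cocycle_identity hc (e w) x y z
    simp only [hc1, koszulTwist_of_mem_zero 𝒜 d (he0 w), zero_mul, sub_zero, add_zero] at this
    exact (sub_eq_zero.1 this).symm
  constructor
  · simp only [diff_two_apply, hz, koszulTwist_of_mem_zero 𝒜 d (he0 w), zero_mul,
      add_zero, averageTwo_apply, mul_assoc, hl, Finset.mul_sum, sub_self]
  -- The cocycle identity at `(x * e v, e v, e w, y)`; the first term drops out because `e v` stands
  -- in the first slot.
  · have key : ∀ v, c ![x * e v, e v, e w * y] - c ![x * e v, e v, e w] * y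
        = c ![x * e v, e v * e w, y] - c ![x * e v, e w, y] := by
      intro v
      have h := cocycle_identity hc (x * e v) (e v) (e w) y
      simp only [hc1, mul_assoc, (he.idem v).eq, mul_zero] at h
      rw [← sub_eq_zero, ← neg_eq_zero, ← h]
      abel
    have hs := Finset.sum_congr rfl fun v (_ : v ∈ Finset.univ) => key v
    have h1 : ∑ v, c ![x * e v, e v * e w, y] = c ![x * e w, e w, y] :=
      sum_mul_idem he.toOrthogonalIdempotents w (fun a v => c ![x * e v, a, y])
        (fun v => map_zero_two _ _ _)
    have h2 : ∑ v, c ![x * e w * e v, e v, y] = c ![x * e w, e w, y] := by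
      simp only [mul_assoc]
      exact sum_idem_mul he.toOrthogonalIdempotents w (fun a v => c ![x * a, e v, y])
        (fun v => by rw [mul_zero, map_zero_one])
    have h3 : ∑ v, c ![x * e v, e w, y] = c ![x, e w, y] := by
      simp only [← slotOne_apply]
      rw [← map_sum, ← Finset.mul_sum, he.complete, mul_one]
    simp only [Finset.sum_sub_distrib, h1, h3, ← Finset.sum_mul] at hs
    rw [diff_two_apply, hz, mul_zero, zero_sub, add_sub_assoc]
    simp only [averageTwo_apply, h2, hs]
    abel

/-- The same homotopy in the third slot. Vanishing in the first two slots gives left linearity `hl`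
and balancing `hm`, which keep both slots clean. -/
theorem diff_averageThree {𝒜 : ℤ → Submodule k A} [GradedAlgebra 𝒜] {d : ℤ} {e : ι → A}
    (he : CompleteOrthogonalIdempotents e) (he0 : ∀ v, e v ∈ 𝒜 0) {c : Cochain k A 3}
    (hc : diff 𝒜 d 3 c = 0) (hc1 : ∀ w y z, c ![e w, y, z] = 0)
    (hc2 : ∀ w y z, c ![y, e w, z] = 0) (w : ι) (x y : A) :
    diff 𝒜 d 2 (averageThree e c) ![e w, x, y] = 0 ∧
    diff 𝒜 d 2 (averageThree e c) ![x, e w, y] = 0 ∧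
    diff 𝒜 d 2 (averageThree e c) ![x, y, e w] = c ![x, y, e w] := by
  have hz1 : ∀ y, averageThree e c ![e w, y] = 0 := fun y => by
    simp only [averageThree_apply, hc1, Finset.sum_const_zero]
  have hz2 : ∀ x, averageThree e c ![x, e w] = 0 := fun x => by
    rw [averageThree_apply, sum_idem_mul he.toOrthogonalIdempotents w
      (fun a v => c ![x, a, e v]) (fun v => map_zero_two _ _ _), hc2]
  have hl : ∀ x y z, c ![e w * x, y, z] = e w * c ![x, y, z] := fun x y z => by
    have := cocycle_identity hc (e w) x y z
    simp only [hc1, koszulTwist_of_mem_zero 𝒜 d (he0 w), zero_mul, sub_zero, add_zero] at this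
    exact (sub_eq_zero.1 this).symm
  have hm : ∀ x y z, c ![x * e w, y, z] = c ![x, e w * y, z] := fun x y z => by
    have := cocycle_identity hc x (e w) y z
    simp only [hc1, hc2, zero_mul, mul_zero, sub_zero, add_zero, zero_sub] at this
    exact neg_add_eq_zero.1 this
  refine ⟨?_, ?_, ?_⟩
  · simp only [diff_two_apply, hz1, koszulTwist_of_mem_zero 𝒜 d (he0 w), zero_mul,
      add_zero, averageThree_apply, hl, Finset.mul_sum, sub_self]
  · simp only [diff_two_apply, hz1, hz2, zero_mul, mul_zero, sub_zero, zero_sub,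
      averageThree_apply, hm, mul_assoc, neg_add_cancel]
  -- The cocycle identity at `(x, y * e v, e v, e w)`.
  · have key : ∀ v, c ![x, y * e v, e v] * e w
        = c ![x, y * e v, e v * e w] - c ![x, y * e v, e w] := by
      intro v
      have h := cocycle_identity hc x (y * e v) (e v) (e w)
      simp only [hc2, mul_assoc, (he.idem v).eq, mul_zero] at h
      rw [← sub_eq_zero, ← h]
      abel
    have hs := Finset.sum_congr rfl fun v (_ : v ∈ Finset.univ) => key v
    have h1 : ∑ v, c ![x, y * e v, e v * e w] = c ![x, y * e w, e w] :=
      sum_mul_idem he.toOrthogonalIdempotents w (fun a v => c ![x, y * e v, a])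
        (fun v => map_zero_three _ _ _)
    have h2 : ∑ v, c ![x, y * e w * e v, e v] = c ![x, y * e w, e w] := by
      simp only [mul_assoc]
      exact sum_idem_mul he.toOrthogonalIdempotents w (fun a v => c ![x, y * a, e v])
        (fun v => by rw [mul_zero, map_zero_two])
    have h3 : ∑ v, c ![x, y * e v, e w] = c ![x, y, e w] := by
      simp only [← slotTwo_apply]
      rw [← map_sum, ← Finset.mul_sum, he.complete, mul_one]
    simp only [Finset.sum_sub_distrib, h1, h3, ← Finset.sum_mul] at hs
    rw [diff_two_apply, hz2, hz2, mul_zero]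
    simp only [averageThree_apply, h2, hs]
    abel

theorem isNormalized_of_span {ι : Type*} {e : ι → A} {S : Subalgebra k A}
    (hS : ∀ s ∈ S, s ∈ Submodule.span k (Set.range e)) {c : Cochain k A 3}
    (h : ∀ w x y, c ![e w, x, y] = 0 ∧ c ![x, e w, y] = 0 ∧ c ![x, y, e w] = 0) :
    IsNormalized S c := by
  rw [isNormalized_three_iff]
  intro s hs x y
  have hle : ∀ L : A →ₗ[k] A, (∀ w, L (e w) = 0) → L s = 0 := fun L hL =>
    (Submodule.span_le (p := LinearMap.ker L)).2 (by rintro _ ⟨w, rfl⟩; exact hL w) (hS s hs)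
  refine ⟨?_, ?_, ?_⟩
  · rw [← slotOne_apply]
    exact hle _ fun w => by rw [slotOne_apply]; exact (h w x y).1
  · rw [← slotTwo_apply]
    exact hle _ fun w => by rw [slotTwo_apply]; exact (h w x y).2.1
  · rw [← slotThree_apply]
    exact hle _ fun w => by rw [slotThree_apply]; exact (h w x y).2.2

/-- Every `3`-cocycle is cohomologous to a normalized cocycle relative to the span of a complete
system of orthogonal idempotents of degree `0`. -/
theorem exists_sub_diff_mem_relCocycles {𝒜 : ℤ → Submodule k A} [GradedAlgebra 𝒜] {d : ℤ}
    {e : ι → A} (he : CompleteOrthogonalIdempotents e) (he0 : ∀ v, e v ∈ 𝒜 0)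
    {S : Subalgebra k A} (hS : ∀ s ∈ S, s ∈ Submodule.span k (Set.range e)) {c : Cochain k A 3}
    (hc : c ∈ cocycles 𝒜 d (cochains 𝒜 d) 3) :
    ∃ f ∈ cochains 𝒜 d 2, c - diff 𝒜 d 2 f ∈ cocycles 𝒜 d (relCochains 𝒜 S d) 3 := by
  have hS0 : ∀ s ∈ S, s ∈ 𝒜 0 := fun s hs =>
    (Submodule.span_le (p := 𝒜 0)).2 (by rintro _ ⟨w, rfl⟩; exact he0 w) (hS s hs)
  have hδ : ∀ f : Cochain k A 2, diff 𝒜 d 3 (c - diff 𝒜 d 2 f) = 0 := fun f => by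
    rw [map_sub, diff_diff_two, sub_zero]; exact hc.2
  have hdeg : ∀ f ∈ cochains 𝒜 d 2, c - diff 𝒜 d 2 f ∈ cochains 𝒜 d 3 := fun f hf =>
    sub_mem hc.1 (diff_two_mem_cochains hf)
  obtain ⟨f₁, hf₁, h₁⟩ : ∃ f ∈ cochains 𝒜 d 2, ∀ w y z,
      (c - diff 𝒜 d 2 f) ![e w, y, z] = 0 :=
    ⟨averageOne e c, averageOne_mem he0 hc.1, fun w y z => by
      rw [_root_.sub_apply, diff_averageOne he he0 hc.2, sub_self]⟩
  obtain ⟨f₂, hf₂, h₂⟩ : ∃ f ∈ cochains 𝒜 d 2, ∀ w y z,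
      (c - diff 𝒜 d 2 f) ![e w, y, z] = 0 ∧ (c - diff 𝒜 d 2 f) ![y, e w, z] = 0 := by
    -- The correction is subtracted because `diff_averageTwo` returns the value with a minus sign;
    -- in the third slot it is added.
    refine ⟨f₁ - averageTwo e (c - diff 𝒜 d 2 f₁),
      sub_mem hf₁ (averageTwo_mem he0 (hdeg _ hf₁)), fun w y z => ?_⟩
    have h := diff_averageTwo he he0 (hδ f₁) h₁ w y z
    rw [map_sub, ← sub_add, _root_.add_apply, _root_.add_apply, h.1, h.2, h₁]
    simp
  obtain ⟨f₃, hf₃, h₃⟩ : ∃ f ∈ cochains 𝒜 d 2, ∀ w y z,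
      (c - diff 𝒜 d 2 f) ![e w, y, z] = 0 ∧ (c - diff 𝒜 d 2 f) ![y, e w, z] = 0 ∧
        (c - diff 𝒜 d 2 f) ![y, z, e w] = 0 := by
    refine ⟨f₂ + averageThree e (c - diff 𝒜 d 2 f₂),
      add_mem hf₂ (averageThree_mem he0 (hdeg _ hf₂)), fun w y z => ?_⟩
    have h := diff_averageThree he he0 (hδ f₂) (fun w y z => (h₂ w y z).1)
      (fun w y z => (h₂ w y z).2) w y z
    rw [map_add, ← sub_sub, _root_.sub_apply, _root_.sub_apply (c - _) _ ![y, e w, z],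
      _root_.sub_apply (c - _) _ ![y, z, e w], h.1, h.2.1, h.2.2, (h₂ w y z).1, (h₂ w y z).2]
    simp
  have hn := isNormalized_of_span hS h₃
  exact ⟨f₃, hf₃, ⟨hdeg _ hf₃, isRelative_of_isNormalized hS0 (hδ _) hn, hn⟩, hδ _⟩

end Normalization

end Hochschild

/-! ### Path constraints on the structure constants of relative cochains -/

namespace Egg

open Hochschild

variable {k : Type*} [Field k] {g : ℕ}

@[simp] theorem sub_coord (x y : E k g) (a : Idx g) : (x - y) a = x a - y a := rfl

@[simp] theorem neg_coord (x : E k g) (a : Idx g) : (-x) a = - x a := rfl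

@[simp] theorem sum_coord {ι : Type*} (s : Finset ι) (x : ι → E k g) (a : Idx g) :
    (∑ i ∈ s, x i) a = ∑ i ∈ s, x i a :=
  Finset.sum_apply a s x

theorem b_coord (a a' : Idx g) : b k a a' = if a' = a then 1 else 0 := rfl

theorem b_mem_grading (a : Idx g) : b k a ∈ grading k g a.deg := by
  intro a' ha'
  rw [b_coord, if_neg]
  rintro rfl
  exact ha' rfl

theorem koszulTwist_coord (x : E k g) (a : Idx g) :
    koszulTwist (grading k g) (-1) x a = if a.deg = 1 then - x a else x a := by
  have hx : x = gradProj k g 0 x + gradProj k g 1 x := by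
    ext a
    simp only [add_coord, gradProj_apply]
    cases a <;> simp [Idx.deg]
  conv_lhs => rw [hx, map_add, koszulTwist_of_mem_zero _ _ (gradProj k g 0 x).2,
    koszulTwist_of_mem _ _ (gradProj k g 1 x).2]
  simp only [mul_one, Int.negOnePow_neg, Int.negOnePow_one, Units.val_neg, Units.val_one, neg_smul,
    one_smul, add_coord, neg_coord, gradProj_apply]
  cases a <;> simp [Idx.deg]

/-- The expansion of an element in the basis. -/
theorem eq_sum_b (x : E k g) : x = x .eO • b k .eO + ∑ i, (x (.eP i) • b k (.eP i)
    + x (.A i) • b k (.A i) + x (.B i) • b k (.B i) + x (.X i) • b k (.X i)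
    + x (.Y i) • b k (.Y i)) := by
  ext a
  cases a <;> simp [b_coord]

theorem linearMap_eq_zero {L : E k g →ₗ[k] E k g} (h : ∀ a, L (b k a) = 0) (x : E k g) :
    L x = 0 := by
  rw [eq_sum_b x]
  simp [h]

theorem cochain_three_eq_zero {c : Cochain k (E k g) 3}
    (h : ∀ a₁ a₂ a₃, c ![b k a₁, b k a₂, b k a₃] = 0) : c = 0 := by
  refine Cochain.ext_three fun x y z => ?_
  rw [_root_.zero_apply, ← slotOne_apply]
  refine linearMap_eq_zero (fun a₁ => ?_) x
  rw [slotOne_apply, ← slotTwo_apply]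
  refine linearMap_eq_zero (fun a₂ => ?_) y
  rw [slotTwo_apply, ← slotThree_apply]
  refine linearMap_eq_zero (fun a₃ => ?_) z
  rw [slotThree_apply]
  exact h a₁ a₂ a₃

/-- The idempotents, indexed by the vertices: `none` stands for `O` and `some i` for `p_i`. -/
def vertexIdx : Option (Fin g) → Idx g
  | none => .eO
  | some i => .eP i

/-- The vertex whose idempotent fixes a basis element from the left. -/
def Idx.left : Idx g → Option (Fin g)
  | .eO => none
  | .eP i => some i
  | .A i => some i
  | .B _ => none
  | .X _ => none
  | .Y i => some i

/-- The vertex whose idempotent fixes a basis element from the right. -/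
def Idx.right : Idx g → Option (Fin g)
  | .eO => none
  | .eP i => some i
  | .A _ => none
  | .B i => some i
  | .X _ => none
  | .Y i => some i

theorem vertex_mul_coord (v : Option (Fin g)) (x : E k g) (a : Idx g) :
    (b k (vertexIdx v) * x) a = if a.left = v then x a else 0 := by
  rw [mul_def]
  cases v <;> cases a <;> simp [mulFun, b_coord, vertexIdx, Idx.left]

theorem mul_vertex_coord (v : Option (Fin g)) (x : E k g) (a : Idx g) :
    (x * b k (vertexIdx v)) a = if a.right = v then x a else 0 := by
  rw [mul_def]
  cases v <;> cases a <;> simp [mulFun, b_coord, vertexIdx, Idx.right]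

theorem vertex_mul_b (v : Option (Fin g)) (a : Idx g) :
    b k (vertexIdx v) * b k a = if a.left = v then b k a else 0 := by
  ext a'
  rw [vertex_mul_coord]
  by_cases h : a' = a
  · subst h; split_ifs <;> rfl
  · simp only [b_coord, h, if_false, ite_self]
    split_ifs <;> simp [b_coord, h]

theorem b_mul_vertex (v : Option (Fin g)) (a : Idx g) :
    b k a * b k (vertexIdx v) = if a.right = v then b k a else 0 := by
  ext a'
  rw [mul_vertex_coord]
  by_cases h : a' = a
  · subst h; split_ifs <;> rfl
  · simp only [b_coord, h, if_false, ite_self]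
    split_ifs <;> simp [b_coord, h]

theorem completeOrthogonalIdempotents_vertex :
    CompleteOrthogonalIdempotents fun v : Option (Fin g) => b k (vertexIdx v) where
  idem v := by
    have : (vertexIdx v).left = v := by cases v <;> rfl
    rw [IsIdempotentElem, vertex_mul_b, if_pos this]
  ortho v w h := by
    have : (vertexIdx w).left = w := by cases w <;> rfl
    change b k (vertexIdx v) * b k (vertexIdx w) = 0
    rw [vertex_mul_b, if_neg (by rw [this]; exact h.symm)]
  complete := by
    ext a
    change _ = oneFun a
    rw [sum_coord, Fintype.sum_option]
    cases a <;> simp [b_coord, vertexIdx, oneFun]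

theorem vertex_mem_idempotents (v : Option (Fin g)) : b k (vertexIdx v) ∈ idempotents k g := by
  refine Algebra.subset_adjoin ?_
  cases v
  · exact Set.mem_insert _ _
  · exact Set.mem_insert_of_mem _ ⟨_, rfl⟩

theorem vertex_mem_grading (v : Option (Fin g)) : b k (vertexIdx v) ∈ grading k g 0 := by
  have h : (vertexIdx v).deg = 0 := by cases v <;> rfl
  rw [← h]
  exact b_mem_grading _

/-- The elements of the subalgebra `R` have no components outside the idempotents. -/
theorem coord_of_mem_idempotents {s : E k g} (hs : s ∈ idempotents k g) (i : Fin g) :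
    s (.A i) = 0 ∧ s (.B i) = 0 ∧ s (.X i) = 0 ∧ s (.Y i) = 0 := by
  induction hs using Algebra.adjoin_induction with
  | mem x hx =>
    rcases hx with rfl | ⟨j, rfl⟩ <;> simp [b_coord]
  | algebraMap r =>
    rw [Algebra.algebraMap_eq_smul_one]
    simp only [smul_coord]
    change r * oneFun (.A i) = 0 ∧ r * oneFun (.B i) = 0 ∧ r * oneFun (.X i) = 0
      ∧ r * oneFun (.Y i) = 0
    simp [oneFun]
  | add x y _ _ hx hy => simp [hx, hy]
  | mul x y _ _ hx hy => simp [mul_def, mulFun, hx, hy]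

theorem mem_span_of_mem_idempotents {s : E k g} (hs : s ∈ idempotents k g) :
    s ∈ Submodule.span k (Set.range fun v : Option (Fin g) => b k (vertexIdx v)) := by
  have h := coord_of_mem_idempotents hs
  have : s = ∑ v : Option (Fin g), s (vertexIdx v) • b k (vertexIdx v) := by
    rw [Fintype.sum_option]
    conv_lhs => rw [eq_sum_b s]
    simp [h, vertexIdx]
  rw [this]
  exact sum_mem fun v _ => Submodule.smul_mem _ _ (Submodule.subset_span ⟨v, rfl⟩)

theorem mem_grading_zero_of_mem_idempotents {s : E k g} (hs : s ∈ idempotents k g) :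
    s ∈ grading k g 0 := by
  have h := coord_of_mem_idempotents hs
  intro a ha
  cases a <;> simp_all [Idx.deg]

/-- The constraints under which a relative cochain of degree `-1` can have a nonzero structure
constant. -/
theorem relCochains_coord_ne_zero {c : Cochain k (E k g) 3}
    (hc : c ∈ relCochains (grading k g) (idempotents k g) (-1) 3) {a₁ a₂ a₃ a : Idx g}
    (h : c ![b k a₁, b k a₂, b k a₃] a ≠ 0) :
    a.left = a₁.left ∧ a₁.right = a₂.left ∧ a₂.right = a₃.left ∧ a.right = a₃.right ∧
      a.deg = a₁.deg + a₂.deg + a₃.deg - 1 ∧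
      ∀ v, a₁ ≠ vertexIdx v ∧ a₂ ≠ vertexIdx v ∧ a₃ ≠ vertexIdx v := by
  obtain ⟨h1, h2, h3⟩ := hc
  rw [isRelative_three_iff] at h2
  rw [isNormalized_three_iff] at h3
  rw [mem_cochains_three] at h1
  refine ⟨?_, ?_, ?_, ?_, ?_, fun v => ⟨?_, ?_, ?_⟩⟩
  -- A basis element is fixed by the idempotents at its two ends. Moving such an idempotent out of
  -- the cochain, or into the neighbouring slot, kills the coefficient unless the vertices agree.
  · by_contra hne
    have := (h2 _ (vertex_mem_idempotents a₁.left) (b k a₁) (b k a₂) (b k a₃)).1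
    rw [vertex_mul_b, if_pos rfl] at this
    rw [this, vertex_mul_coord, if_neg hne] at h
    exact h rfl
  · by_contra hne
    have := (h2 _ (vertex_mem_idempotents a₁.right) (b k a₁) (b k a₂) (b k a₃)).2.2.1
    rw [b_mul_vertex, if_pos rfl, vertex_mul_b, if_neg (Ne.symm hne), map_zero_two] at this
    exact h (by rw [this]; rfl)
  · by_contra hne
    have := (h2 _ (vertex_mem_idempotents a₂.right) (b k a₁) (b k a₂) (b k a₃)).2.2.2
    rw [b_mul_vertex, if_pos rfl, vertex_mul_b, if_neg (Ne.symm hne), map_zero_three] at this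
    exact h (by rw [this]; rfl)
  · by_contra hne
    have := (h2 _ (vertex_mem_idempotents a₃.right) (b k a₁) (b k a₂) (b k a₃)).2.1
    rw [b_mul_vertex, if_pos rfl] at this
    rw [this, mul_vertex_coord, if_neg hne] at h
    exact h rfl
  · by_contra hne
    exact h (h1 _ _ _ _ _ _ (b_mem_grading a₁) (b_mem_grading a₂) (b_mem_grading a₃) a
      (by rwa [← sub_eq_add_neg]))
  · rintro rfl
    exact h (by rw [(h3 _ (vertex_mem_idempotents v) _ _).1]; rfl)
  · rintro rfl
    exact h (by rw [(h3 _ (vertex_mem_idempotents v) _ _).2.1]; rfl)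
  · rintro rfl
    exact h (by rw [(h3 _ (vertex_mem_idempotents v) _ _).2.2]; rfl)

/-- The labels that satisfy the constraints of `relCochains_coord_ne_zero`. -/
theorem idx_cases {a₁ a₂ a₃ a : Idx g} (h₁ : a.left = a₁.left) (h₂ : a₁.right = a₂.left)
    (h₃ : a₂.right = a₃.left) (h₄ : a.right = a₃.right)
    (hdeg : a.deg = a₁.deg + a₂.deg + a₃.deg - 1)
    (hv : ∀ v, a₁ ≠ vertexIdx v ∧ a₂ ≠ vertexIdx v ∧ a₃ ≠ vertexIdx v) :
    (∃ i, a₁ = .A i ∧ a₂ = .B i ∧ a₃ = .Y i ∧ a = .Y i) ∨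
    (∃ i j, a₁ = .A i ∧ a₂ = .X j ∧ a₃ = .B i ∧ a = .Y i) ∨
    (∃ i, a₁ = .Y i ∧ a₂ = .A i ∧ a₃ = .B i ∧ a = .Y i) ∨
    (∃ i j, a₁ = .A i ∧ a₂ = .B j ∧ a₃ = .A j ∧ a = .A i) ∨
    (∃ i j, a₁ = .B i ∧ a₂ = .A i ∧ a₃ = .B j ∧ a = .B j) ∨
    (∃ i j l, a₁ = .B i ∧ a₂ = .A i ∧ a₃ = .X j ∧ a = .X l) ∨
    (∃ i l, a₁ = .B i ∧ a₂ = .Y i ∧ a₃ = .A i ∧ a = .X l) ∨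
    (∃ i j l, a₁ = .X i ∧ a₂ = .B j ∧ a₃ = .A j ∧ a = .X l) := by
  have hO := hv none
  have hP₁ := fun i => (hv (some i)).1
  have hP₂ := fun i => (hv (some i)).2.1
  have hP₃ := fun i => (hv (some i)).2.2
  clear hv
  simp only [vertexIdx] at hO hP₁ hP₂ hP₃
  -- Labels are pruned as soon as an argument is an idempotent or fails to compose with its
  -- predecessor, so the output is examined only for genuine paths of length three.
  rcases a₁ with _ | i₁ | i₁ | i₁ | i₁ | i₁
  · exact absurd rfl hO.1
  · exact absurd rfl (hP₁ i₁)
  all_goals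
    clear hP₁
    rcases a₂ with _ | i₂ | i₂ | i₂ | i₂ | i₂ <;>
      first
      | (simp [Idx.left, Idx.right] at h₂; done)
      | exact absurd rfl hO.2.1
      | exact absurd rfl (hP₂ i₂)
      | (clear hP₂
         rcases a₃ with _ | i₃ | i₃ | i₃ | i₃ | i₃ <;>
          first
          | (simp [Idx.left, Idx.right] at h₃; done)
          | exact absurd rfl hO.2.2
          | exact absurd rfl (hP₃ i₃)
          | (clear hP₃ hO
             rcases a with _ | i | i | i | i | i <;>
              first
              | (simp [Idx.deg] at hdeg; done)
              | (simp [Idx.left] at h₁; done)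
              | (simp [Idx.right] at h₄; done)
              | (simp only [Idx.left, Idx.right, Option.some.injEq] at h₁ h₂ h₃ h₄
                 subst_vars
                 simp)))

/-- A relative cochain of degree `-1` is zero once eight families of structure constants
vanish. -/
theorem relCochains_eq_zero {c : Cochain k (E k g) 3}
    (hc : c ∈ relCochains (grading k g) (idempotents k g) (-1) 3)
    (hABY : ∀ i, c ![b k (.A i), b k (.B i), b k (.Y i)] (.Y i) = 0)
    (hAXB : ∀ i j, c ![b k (.A i), b k (.X j), b k (.B i)] (.Y i) = 0)
    (hYAB : ∀ i, c ![b k (.Y i), b k (.A i), b k (.B i)] (.Y i) = 0)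
    (hABA : ∀ i j, c ![b k (.A i), b k (.B j), b k (.A j)] (.A i) = 0)
    (hBAB : ∀ i j, c ![b k (.B i), b k (.A i), b k (.B j)] (.B j) = 0)
    (hBAX : ∀ i j l, c ![b k (.B i), b k (.A i), b k (.X j)] (.X l) = 0)
    (hBYA : ∀ i l, c ![b k (.B i), b k (.Y i), b k (.A i)] (.X l) = 0)
    (hXBA : ∀ i j l, c ![b k (.X i), b k (.B j), b k (.A j)] (.X l) = 0) : c = 0 := by
  refine cochain_three_eq_zero fun a₁ a₂ a₃ => ?_
  ext a
  by_contra h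
  rw [zero_coord] at h
  obtain ⟨h₁, h₂, h₃, h₄, hdeg, hv⟩ := relCochains_coord_ne_zero hc h
  obtain ⟨i, rfl, rfl, rfl, rfl⟩ | ⟨i, j, rfl, rfl, rfl, rfl⟩ | ⟨i, rfl, rfl, rfl, rfl⟩ |
    ⟨i, j, rfl, rfl, rfl, rfl⟩ | ⟨i, j, rfl, rfl, rfl, rfl⟩ | ⟨i, j, l, rfl, rfl, rfl, rfl⟩ |
    ⟨i, l, rfl, rfl, rfl, rfl⟩ | ⟨i, j, l, rfl, rfl, rfl, rfl⟩ := idx_cases h₁ h₂ h₃ h₄ hdeg hv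
  · exact h (hABY i)
  · exact h (hAXB i j)
  · exact h (hYAB i)
  · exact h (hABA i j)
  · exact h (hBAB i j)
  · exact h (hBAX i j l)
  · exact h (hBYA i l)
  · exact h (hXBA i j l)

end Egg

/-! ### Relative cocycles with vanishing invariants are coboundaries -/

namespace Egg

open Hochschild

variable {k : Type*} [Field k] {g : ℕ}

/-- The bilinear operation of degree `-1` with
`(A_i, B_i) ↦ u_i e_{p_i}`, `(A_i, X_j) ↦ v_{ij} A_i`, `(B_i, Y_i) ↦ r_i B_i`,
`(X_i, B_j) ↦ s_{ij} B_j`, `(X_i, X_j) ↦ ∑_l t_{ijl} X_l` and `(Y_i, Y_i) ↦ z_i Y_i`. -/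
def binaryFun (u r z : Fin g → k) (v s : Fin g → Fin g → k) (t : Fin g → Fin g → Fin g → k)
    (x y : E k g) : E k g
  | .eO => 0
  | .eP i => u i * (x (.A i) * y (.B i))
  | .A i => ∑ j, v i j * (x (.A i) * y (.X j))
  | .B j => r j * (x (.B j) * y (.Y j)) + ∑ i, s i j * (x (.X i) * y (.B j))
  | .X l => ∑ i, ∑ j, t i j l * (x (.X i) * y (.X j))
  | .Y i => z i * (x (.Y i) * y (.Y i))

/-- The cochain of `binaryFun`. -/
def binaryCochain (u r z : Fin g → k) (v s : Fin g → Fin g → k)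
    (t : Fin g → Fin g → Fin g → k) : Cochain k (E k g) 2 :=
  ofBilin <| LinearMap.mk₂ k (binaryFun u r z v s t)
    (fun x x' y => by
      ext a; cases a <;> simp [binaryFun, add_mul, mul_add, Finset.sum_add_distrib]; ring)
    (fun c x y => by
      ext a; cases a <;> simp only [binaryFun, smul_coord, mul_add, Finset.mul_sum, mul_assoc,
        mul_left_comm, mul_zero])
    (fun x y y' => by
      ext a; cases a <;> simp [binaryFun, mul_add, Finset.sum_add_distrib]; ring)
    (fun c x y => by
      ext a; cases a <;> simp only [binaryFun, smul_coord, mul_add, Finset.mul_sum,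
        mul_left_comm, mul_zero])

theorem binaryCochain_apply (u r z : Fin g → k) (v s : Fin g → Fin g → k)
    (t : Fin g → Fin g → Fin g → k) (x y : E k g) :
    binaryCochain u r z v s t ![x, y] = binaryFun u r z v s t x y := rfl

theorem binaryCochain_mem (u r z : Fin g → k) (v s : Fin g → Fin g → k)
    (t : Fin g → Fin g → Fin g → k) :
    binaryCochain u r z v s t ∈ relCochains (grading k g) (idempotents k g) (-1) 2 := by
  refine ⟨?_, ?_, ?_⟩
  · rw [mem_cochains_two]
    intro p q x y hx hy a ha
    -- Every monomial of `binaryFun` pairs two coordinates whose degrees add up to one more than the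
    -- degree of the output; off that degree one of the two factors vanishes.
    have key : ∀ (a₁ a₂ : Idx g), a₁.deg + a₂.deg + -1 = a.deg → ∀ w, w * (x a₁ * y a₂) = 0 := by
      intro a₁ a₂ h w
      by_cases h1 : a₁.deg = p
      · rw [hy a₂ (fun h2 => ha (by rw [← h, h1, h2])), mul_zero, mul_zero]
      · rw [hx a₁ h1, zero_mul, mul_zero]
    change binaryFun u r z v s t x y a = 0
    cases a with
    | eO => rfl
    | eP i => exact key _ _ rfl _
    | A i => exact Finset.sum_eq_zero fun j _ => key _ _ rfl _
    | B j =>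
      exact (congrArg₂ (· + ·) (key _ _ rfl _)
        (Finset.sum_eq_zero fun i _ => key _ _ rfl _)).trans (add_zero 0)
    | X l => exact Finset.sum_eq_zero fun i _ => Finset.sum_eq_zero fun j _ => key _ _ rfl _
    | Y i => exact key _ _ rfl _
  · rw [isRelative_two_iff]
    intro e he x y
    have h := coord_of_mem_idempotents he
    simp only [binaryCochain_apply]
    refine ⟨?_, ?_, ?_⟩ <;> ext a <;>
      cases a <;> simp [binaryFun, mul_def, mulFun, h, Finset.mul_sum, mul_add,
        mul_assoc, mul_left_comm, mul_comm]
  · rw [isNormalized_two_iff]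
    intro e he x
    have h := coord_of_mem_idempotents he
    simp only [binaryCochain_apply]
    constructor <;> ext a <;> cases a <;> simp [binaryFun, h]

theorem A_mul_B (i j : Fin g) : b k (.A i) * b k (.B j) = if i = j then b k (.Y i) else 0 := by
  ext a
  split_ifs with h <;> cases a <;> simp [mul_def, mulFun, b_coord]
  all_goals grind

theorem B_mul_A (i j : Fin g) : b k (.B i) * b k (.A j) = if i = j then b k (.X i) else 0 := by
  ext a
  split_ifs with h <;> cases a <;> simp [mul_def, mulFun, b_coord]
  all_goals grind

/-- A relative cocycle of degree `-1` with vanishing `α_{ij}`, `i ≠ j`, is the differential of a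
relative cochain. -/
theorem exists_diff_eq_of_alpha_eq_zero (hk : (2 : k) ≠ 0) {c : Cochain k (E k g) 3}
    (hc : c ∈ cocycles (grading k g) (-1)
      (relCochains (grading k g) (idempotents k g) (-1)) 3)
    (hα : ∀ i j, i ≠ j → alpha c i j = 0) :
    ∃ f ∈ relCochains (grading k g) (idempotents k g) (-1) 2,
      diff (grading k g) (-1) 2 f = c := by
  -- The parameters are found by equating coefficients of `δf` and `c`. At `(B_i, Y_i, A_i)` the
  -- `X_i`-coefficient of `δf` is `-r_i`, which accounts for the diagonal `α_{ii}`.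
  obtain ⟨r, hr⟩ : ∃ r : Fin g → k, ∀ i, r i = - alpha c i i := ⟨_, fun _ => rfl⟩
  -- The `Y_i`-coefficient of `δf` is `r_i - z_i - u_i` at `(A_i, B_i, Y_i)` and `z_i - u_i` at
  -- `(Y_i, A_i, B_i)`. Adding the two eliminates `z_i` and leaves `r_i - 2 u_i`; this is where
  -- characteristic `≠ 2` enters.
  obtain ⟨u, hu⟩ : ∃ u : Fin g → k, ∀ i, 2 * u i
      = r i - c ![b k (.A i), b k (.B i), b k (.Y i)] (.Y i)
        - c ![b k (.Y i), b k (.A i), b k (.B i)] (.Y i) :=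
    ⟨fun i => _ / 2, fun i => mul_div_cancel₀ _ hk⟩
  obtain ⟨z, hz⟩ : ∃ z : Fin g → k, ∀ i, z i
      = r i - u i - c ![b k (.A i), b k (.B i), b k (.Y i)] (.Y i) := ⟨_, fun _ => rfl⟩
  -- The relevant coefficients of `δf`, with `[·]` equal to `1` or `0`: `v_{ij} - [i = j] u_i` at
  -- `(A_i, B_j, A_j)`, `-s_{ij} + [i = j] (r_i - u_i)` at `(B_i, A_i, B_j)`, and `-t_{ijl} - [i =
  -- l] v_{ij}` at `(B_i, A_i, X_j)`.
  obtain ⟨v, hv⟩ : ∃ v : Fin g → Fin g → k, ∀ i j, v i j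
      = c ![b k (.A i), b k (.B j), b k (.A j)] (.A i) + if i = j then u i else 0 :=
    ⟨_, fun _ _ => rfl⟩
  obtain ⟨s, hs⟩ : ∃ s : Fin g → Fin g → k, ∀ i j, s i j
      = - c ![b k (.B i), b k (.A i), b k (.B j)] (.B j) + if i = j then r i - u i else 0 :=
    ⟨_, fun _ _ => rfl⟩
  obtain ⟨t, ht⟩ : ∃ t : Fin g → Fin g → Fin g → k, ∀ i j l, t i j l
      = - c ![b k (.B i), b k (.A i), b k (.X j)] (.X l) - if i = l then v i j else 0 :=
    ⟨_, fun _ _ _ => rfl⟩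
  refine ⟨binaryCochain u r z v s t, binaryCochain_mem u r z v s t, ?_⟩
  set f := binaryCochain u r z v s t with hf
  have hmem : c - diff (grading k g) (-1) 2 f
      ∈ relCochains (grading k g) (idempotents k g) (-1) 3 :=
    sub_mem hc.1 (diff_two_mem_relCochains (fun _ => mem_grading_zero_of_mem_idempotents)
      (binaryCochain_mem u r z v s t))
  have hδ : diff (grading k g) (-1) 3 (c - diff (grading k g) (-1) 2 f) = 0 := by
    rw [map_sub, diff_diff_two, sub_zero]; exact hc.2
  have val : ∀ x y z' a, (c - diff (grading k g) (-1) 2 f) ![x, y, z'] a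
      = c ![x, y, z'] a - ((koszulTwist (grading k g) (-1) x * binaryFun u r z v s t y z') a
        - binaryFun u r z v s t (x * y) z' a + binaryFun u r z v s t x (y * z') a
        - (binaryFun u r z v s t x y * z') a) := fun x y z' a => by
    rw [_root_.sub_apply, diff_two_apply]; rfl
  have hABY : ∀ i, (c - diff (grading k g) (-1) 2 f) ![b k (.A i), b k (.B i), b k (.Y i)] (.Y i)
      = 0 := fun i => by
    rw [val]
    simp [mul_def, mulFun, binaryFun, b_coord, koszulTwist_coord, Idx.deg]
    rw [hz]; ring
  have hYAB : ∀ i, (c - diff (grading k g) (-1) 2 f) ![b k (.Y i), b k (.A i), b k (.B i)] (.Y i)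
      = 0 := fun i => by
    rw [val]
    simp [mul_def, mulFun, binaryFun, b_coord, koszulTwist_coord, Idx.deg]
    rw [hz]; linear_combination hu i
  have hABA : ∀ i j, (c - diff (grading k g) (-1) 2 f) ![b k (.A i), b k (.B j), b k (.A j)] (.A i)
      = 0 := fun i j => by
    rw [val]
    simp [mul_def, mulFun, binaryFun, b_coord, koszulTwist_coord, Idx.deg]
    by_cases hij : i = j
    · subst hij; simp [hv]
    · simp [hv, hij]
  have hBAB : ∀ i j, (c - diff (grading k g) (-1) 2 f) ![b k (.B i), b k (.A i), b k (.B j)] (.B j)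
      = 0 := fun i j => by
    rw [val]
    simp [mul_def, mulFun, binaryFun, b_coord, koszulTwist_coord, Idx.deg]
    by_cases hij : i = j
    · subst hij; simp only [if_true, hs]; ring
    · simp [hs, hij, Ne.symm hij]
  have hBAX : ∀ i j l, (c - diff (grading k g) (-1) 2 f)
      ![b k (.B i), b k (.A i), b k (.X j)] (.X l) = 0 := fun i j l => by
    rw [val]
    simp [mul_def, mulFun, binaryFun, b_coord, koszulTwist_coord, Idx.deg]
    by_cases hil : i = l
    · subst hil; simp only [if_true, ht]; ring
    · simp [ht, hil, Ne.symm hil]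
  have hBYA : ∀ i l, (c - diff (grading k g) (-1) 2 f)
      ![b k (.B i), b k (.Y i), b k (.A i)] (.X l) = 0 := fun i l => by
    rw [val]
    simp [mul_def, mulFun, binaryFun, b_coord, koszulTwist_coord, Idx.deg]
    by_cases hil : i = l
    · subst hil
      simp [hr, alpha]
    · simpa [Ne.symm hil, alpha] using hα i l hil
  refine (sub_eq_zero.1 (relCochains_eq_zero hmem hABY ?_ hYAB hABA hBAB hBAX hBYA ?_)).symm
  -- In the cocycle identity at `(A_i, B_j, A_j, B_i)` the middle product `B_j A_j = X_j` produces
  -- the wanted constant; all other terms belong to families already killed.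
  · intro i j
    have h := congrArg (fun x : E k g => x (.Y i))
      (cocycle_identity hδ (b k (.A i)) (b k (.B j)) (b k (.A j)) (b k (.B i)))
    generalize c - diff (grading k g) (-1) 2 f = c' at *
    rw [A_mul_B, A_mul_B, B_mul_A, if_pos rfl] at h
    have h0 := hBAB j i
    have h1 := hABA i j
    by_cases hij : i = j
    · subst hij
      simpa [mul_def, mulFun, koszulTwist_coord, Idx.deg, b_coord, h0, h1, hABY i, hYAB i] using h
    · simpa [mul_def, mulFun, koszulTwist_coord, Idx.deg, b_coord, h0, h1, hij, Ne.symm hij,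
        map_zero_one, map_zero_three] using h
  -- The cocycle identity at `(B_i, A_i, B_j, A_j)` does the same through the first product `B_i A_i
  -- = X_i`.
  · intro i j l
    have h := congrArg (fun x : E k g => x (.X l))
      (cocycle_identity hδ (b k (.B i)) (b k (.A i)) (b k (.B j)) (b k (.A j)))
    generalize c - diff (grading k g) (-1) 2 f = c' at *
    rw [A_mul_B, B_mul_A, B_mul_A, if_pos rfl, if_pos rfl] at h
    have h1 : (koszulTwist (grading k g) (-1) (b k (.B i))
        * c' ![b k (.A i), b k (.B j), b k (.A j)]) (.X l) = 0 := by
      by_cases hil : l = i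
      · subst hil
        simp [mul_def, mulFun, koszulTwist_coord, Idx.deg, b_coord, hABA l j]
      · simp [mul_def, mulFun, koszulTwist_coord, Idx.deg, b_coord, hil]
    have h2 : (c' ![b k (.B i), b k (.A i), b k (.B j)] * b k (.A j)) (.X l) = 0 := by
      by_cases hjl : l = j
      · subst hjl
        simp [mul_def, mulFun, b_coord, hBAB i l]
      · simp [mul_def, mulFun, b_coord, hjl]
    have h3 : c' ![b k (.B i), if i = j then b k (.Y i) else 0, b k (.A j)] (.X l) = 0 := by
      split_ifs with hij
      · subst hij
        exact hBYA i l
      · rw [map_zero_two]; rfl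
    simpa [h1, h2, h3, hBAX i j l] using h

end Egg

/-! ### Cocycles with prescribed invariants, and the isomorphism -/

namespace Egg

open Hochschild

variable {k : Type*} [Field k] {g : ℕ}

/-- The trilinear operation of degree `-1` with
`(B_i, Y_i, A_i) ↦ ∑_l M_{il} X_l` and `(B_i, A_i, X_i) ↦ ∑_l M_{il} X_l`. -/
def ternaryFun (M : Matrix (Fin g) (Fin g) k) (x y z : E k g) : E k g
  | .X l => ∑ i, M i l * (x (.B i) * (y (.Y i) * z (.A i) + y (.A i) * z (.X i)))
  | _ => 0

/-- The cochain of `ternaryFun`. -/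
def ternaryCochain (M : Matrix (Fin g) (Fin g) k) : Cochain k (E k g) 3 :=
  MultilinearMap.mk' (fun v => ternaryFun M (v 0) (v 1) (v 2))
    (fun v i x y => by
      ext a
      cases a <;> simp only [ternaryFun, add_coord, add_zero]
      rw [← Finset.sum_add_distrib]
      refine Finset.sum_congr rfl fun j _ => ?_
      fin_cases i <;> simp <;> ring)
    (fun v i c x => by
      ext a
      cases a <;> simp only [ternaryFun, smul_coord, mul_zero]
      rw [Finset.mul_sum]
      refine Finset.sum_congr rfl fun j _ => ?_
      fin_cases i <;> simp <;> ring)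

theorem ternaryCochain_apply (M : Matrix (Fin g) (Fin g) k) (x y z : E k g) :
    ternaryCochain M ![x, y, z] = ternaryFun M x y z := rfl

theorem alpha_ternaryCochain (M : Matrix (Fin g) (Fin g) k) (i j : Fin g) :
    alpha (ternaryCochain M) i j = M i j := by
  rw [alpha, ternaryCochain_apply]
  simp [ternaryFun, b_coord]

/-- The critical instance of the cocycle identity is `(B_i, A_i, B_i, A_i)`: contracting `A_i B_i =
Y_i` and contracting the last `B_i A_i = X_i` give equal values with opposite signs. This is why
`ternaryFun` needs its second term. -/
theorem ternaryCochain_mem (M : Matrix (Fin g) (Fin g) k) :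
    ternaryCochain M ∈ cocycles (grading k g) (-1)
      (relCochains (grading k g) (idempotents k g) (-1)) 3 := by
  refine ⟨⟨?_, ?_, ?_⟩, ?_⟩
  · rw [mem_cochains_three]
    intro p q r x y z hx hy hz a ha
    change ternaryFun M x y z a = 0
    cases a with
    | X l =>
      refine Finset.sum_eq_zero fun i _ => ?_
      have key : ∀ (a₂ a₃ : Idx g), a₂.deg + a₃.deg = 1 → x (.B i) * (y a₂ * z a₃) = 0 := by
        intro a₂ a₃ h
        by_cases h1 : (Idx.B i).deg = p
        · by_cases h2 : a₂.deg = q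
          · rw [hz a₃, mul_zero, mul_zero]
            intro h3
            simp only [Idx.deg] at ha h1
            omega
          · rw [hy a₂ h2, zero_mul, mul_zero]
        · rw [hx _ h1, zero_mul]
      rw [mul_add, key (.Y i) (.A i) rfl, key (.A i) (.X i) rfl, add_zero, mul_zero]
    | _ => rfl
  · rw [isRelative_three_iff]
    intro e he x y z
    have h := coord_of_mem_idempotents he
    simp only [ternaryCochain_apply]
    refine ⟨?_, ?_, ?_, ?_⟩ <;> ext a <;> cases a <;>
      simp only [ternaryFun, mul_def, mulFun, h, mul_zero, zero_mul, add_zero, zero_add,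
        Finset.mul_sum, Finset.sum_mul] <;>
      exact Finset.sum_congr rfl fun i _ => by ring
  · rw [isNormalized_three_iff]
    intro e he x y
    have h := coord_of_mem_idempotents he
    simp only [ternaryCochain_apply]
    refine ⟨?_, ?_, ?_⟩ <;> ext a <;> cases a <;> simp [ternaryFun, h]
  · change diff (grading k g) (-1) 3 (ternaryCochain M) = 0
    refine Cochain.ext_four fun x y z w => ?_
    rw [diff_three_apply]
    simp only [ternaryCochain_apply]
    ext a
    cases a <;> simp only [ternaryFun, mul_def, mulFun, add_coord, sub_coord, koszulTwist_coord,
      Idx.deg, mul_zero, zero_mul, add_zero, sub_zero, _root_.zero_apply, zero_coord,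
      Finset.mul_sum, Finset.sum_mul, ← Finset.sum_add_distrib, ← Finset.sum_sub_distrib]
    rw [zero_add, ← Finset.sum_add_distrib]
    refine Finset.sum_eq_zero fun i _ => ?_
    norm_num
    ring

/-- A coboundary does not contribute to `α_{ij}` for `i ≠ j`. -/
theorem alpha_diff (f : Cochain k (E k g) 2) {i j : Fin g} (hij : i ≠ j) :
    alpha (diff (grading k g) (-1) 2 f) i j = 0 := by
  -- Once both inner products vanish, only `-B_i f(Y_i, A_i) - f(B_i, Y_i) A_i` is left, whose
  -- `X_j`-coefficient is zero for `j ≠ i`.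
  have h1 : b k (.B i) * b k (.Y i) = 0 := by
    ext a; cases a <;> simp [mul_def, mulFun, b_coord]
  have h2 : b k (.Y i) * b k (.A i) = 0 := by
    ext a; cases a <;> simp [mul_def, mulFun, b_coord]
  have h3 : f ![0, b k (.A i)] = 0 := f.map_coord_zero 0 rfl
  have h4 : f ![b k (.B i), 0] = 0 := f.map_coord_zero 1 rfl
  rw [alpha, diff_two_apply, h1, h2, h3, h4]
  simp [mul_def, mulFun, koszulTwist_coord, b_coord, Idx.deg, Ne.symm hij]

/-- The off-diagonal matrix `(α_{ij}(c))`. -/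
def alphaMap (k : Type*) [Field k] (g : ℕ) : Cochain k (E k g) 3 →ₗ[k] zeroDiag k g where
  toFun c := ⟨fun i j => if i = j then 0 else alpha c i j, fun i => if_pos rfl⟩
  map_add' c c' := by
    apply Subtype.ext
    ext i j
    change (if i = j then 0 else alpha (c + c') i j)
      = (if i = j then 0 else alpha c i j) + (if i = j then 0 else alpha c' i j)
    split_ifs
    · rw [add_zero]
    · rfl
  map_smul' r c := by
    apply Subtype.ext
    ext i j
    change (if i = j then 0 else alpha (r • c) i j) = r * (if i = j then 0 else alpha c i j)
    split_ifs
    · rw [mul_zero]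
    · rfl

theorem alphaMap_apply (c : Cochain k (E k g) 3) (i j : Fin g) :
    (alphaMap k g c : Matrix (Fin g) (Fin g) k) i j = if i = j then 0 else alpha c i j := rfl

theorem alphaMap_eq_zero_iff {c : Cochain k (E k g) 3} :
    alphaMap k g c = 0 ↔ ∀ i j, i ≠ j → alpha c i j = 0 := by
  refine ⟨fun h i j hij => ?_, fun h => Subtype.ext (Matrix.ext fun i j => ?_)⟩
  · have := congrArg (fun M : zeroDiag k g => (M : Matrix (Fin g) (Fin g) k) i j) h
    simpa [alphaMap_apply, hij] using this
  · rw [alphaMap_apply]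
    split_ifs with hij
    · rfl
    · exact h i j hij

theorem alphaMap_diff (f : Cochain k (E k g) 2) :
    alphaMap k g (diff (grading k g) (-1) 2 f) = 0 :=
  alphaMap_eq_zero_iff.2 fun _ _ hij => alpha_diff f hij

theorem alphaMap_ternaryCochain (M : zeroDiag k g) : alphaMap k g (ternaryCochain M.1) = M := by
  refine Subtype.ext (Matrix.ext fun i j => ?_)
  rw [alphaMap_apply, alpha_ternaryCochain]
  split_ifs with hij
  · rw [hij]; exact (M.2 j).symm
  · rfl

/-- Normalization changes the cocycle only by a coboundary, which `alphaMap` does not see, so the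
relative case applies to the normalized representative. -/
theorem exists_diff_eq_of_mem_cochains (hk : (2 : k) ≠ 0) {c : Cochain k (E k g) 3}
    (hc : c ∈ cocycles (grading k g) (-1) (cochains (grading k g) (-1)) 3)
    (hα : alphaMap k g c = 0) :
    ∃ f ∈ cochains (grading k g) (-1) 2, diff (grading k g) (-1) 2 f = c := by
  obtain ⟨f, hf, hcf⟩ := exists_sub_diff_mem_relCocycles completeOrthogonalIdempotents_vertex
    vertex_mem_grading (S := idempotents k g) (fun _ => mem_span_of_mem_idempotents) hc
  have h0 : alphaMap k g (c - diff (grading k g) (-1) 2 f) = 0 := by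
    rw [map_sub, hα, alphaMap_diff, sub_zero]
  obtain ⟨f', hf', h⟩ := exists_diff_eq_of_alpha_eq_zero hk hcf (alphaMap_eq_zero_iff.1 h0)
  exact ⟨f' + f, add_mem hf'.1 hf, by rw [map_add, h, sub_add_cancel]⟩

/-- A subcomplex that contains the cocycles `ternaryCochain M`, and in which the cocycles killed by
`alphaMap` are coboundaries, has the zero-diagonal matrices as its third cohomology. -/
theorem exists_cohomology_equiv (C : (n : ℕ) → Submodule k (Cochain k (E k g) n))
    (hsurj : ∀ M, ternaryCochain M ∈ cocycles (grading k g) (-1) C 3)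
    (hinj : ∀ c ∈ cocycles (grading k g) (-1) C 3, alphaMap k g c = 0 →
      ∃ f ∈ C 2, diff (grading k g) (-1) 2 f = c) :
    ∃ Φ : Cohomology (grading k g) (-1) C 3 ≃ₗ[k] zeroDiag k g,
      ∀ c : cocycles (grading k g) (-1) C 3,
        Φ (Submodule.Quotient.mk c) = alphaMap k g c.1 := by
  set φ : cocycles (grading k g) (-1) C 3 →ₗ[k] zeroDiag k g :=
    alphaMap k g ∘ₗ (cocycles (grading k g) (-1) C 3).subtype
  -- One inclusion holds for the differential of any binary cochain, so it imposes no condition on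
  -- `C`; the other is `hinj`.
  have hker : (coboundaries (grading k g) (-1) C 3).submoduleOf (cocycles (grading k g) (-1) C 3)
      = LinearMap.ker φ := by
    ext c
    change c.1 ∈ coboundaries (grading k g) (-1) C 3 ↔ φ c = 0
    constructor
    · rintro ⟨f, -, hf⟩
      change alphaMap k g c.1 = 0
      rw [← hf, alphaMap_diff]
    · intro h
      obtain ⟨f, hf, hfc⟩ := hinj c.1 c.2 h
      exact ⟨f, hf, hfc⟩
  have hφs : Function.Surjective φ := fun M =>
    ⟨⟨ternaryCochain M.1, hsurj M.1⟩, alphaMap_ternaryCochain M⟩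
  exact ⟨(Submodule.quotEquivOfEq _ _ hker).trans (φ.quotKerEquivOfSurjective hφs), fun c => rfl⟩

/-- The value of a relative cochain of degree `-1` at `(B_i, Y_i, A_i)`. -/
theorem relCochains_apply_BYA {c : Cochain k (E k g) 3}
    (hc : c ∈ relCochains (grading k g) (idempotents k g) (-1) 3) (i : Fin g) :
    c ![b k (.B i), b k (.Y i), b k (.A i)] = ∑ j, alpha c i j • b k (.X j) := by
  ext a
  by_cases ha : ∃ l, a = .X l
  · obtain ⟨l, rfl⟩ := ha
    simp [b_coord, alpha]
  · have h0 : (∑ j, alpha c i j • b k (.X j) : E k g) a = 0 := by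
      rw [sum_coord]
      refine Finset.sum_eq_zero fun j _ => ?_
      rw [smul_coord, b_coord, if_neg fun h => ha ⟨j, h⟩, mul_zero]
    rw [h0]
    by_contra h
    -- The output is a loop at `O` of degree `1 + 1 + 0 - 1 = 1`; the degree rules out `e_O` and
    -- leaves only the `X_l`.
    obtain ⟨h₁, -, -, h₄, hdeg, -⟩ := relCochains_coord_ne_zero hc h
    cases a <;> simp_all [Idx.left, Idx.right, Idx.deg]

end Egg

theorem mainTheorem3 (k : Type*) [Field k] (hk : ringChar k ≠ 2) (g : ℕ) :
    (∃ Φ : Hochschild.HH (Egg.grading k g) 3 (-1) ≃ₗ[k] Egg.zeroDiag k g,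
      ∀ (c : Hochschild.cocycles (Egg.grading k g) (-1)
          (Hochschild.cochains (Egg.grading k g) (-1)) 3) (i j : Fin g), i ≠ j →
        (Φ (Submodule.Quotient.mk c) : Matrix (Fin g) (Fin g) k) i j = Egg.alpha c.1 i j) ∧
    (∃ Φ : Hochschild.RelHH (Egg.grading k g) (Egg.idempotents k g) 3 (-1) ≃ₗ[k]
        Egg.zeroDiag k g,
      ∀ (c : Hochschild.cocycles (Egg.grading k g) (-1)
          (Hochschild.relCochains (Egg.grading k g) (Egg.idempotents k g) (-1)) 3) (i : Fin g),
        c.1 ![Egg.b k (.B i), Egg.b k (.Y i), Egg.b k (.A i)]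
            = ∑ j, Egg.alpha c.1 i j • Egg.b k (.X j) ∧
        ∀ j, i ≠ j →
          (Φ (Submodule.Quotient.mk c) : Matrix (Fin g) (Fin g) k) i j = Egg.alpha c.1 i j) := by
  have h2 : (2 : k) ≠ 0 := Ring.two_ne_zero hk
  constructor
  · obtain ⟨Φ, hΦ⟩ := Egg.exists_cohomology_equiv (Hochschild.cochains (Egg.grading k g) (-1))
      (fun M => ⟨(Egg.ternaryCochain_mem M).1.1, (Egg.ternaryCochain_mem M).2⟩)
      (fun c hc hα => Egg.exists_diff_eq_of_mem_cochains h2 hc hα)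
    refine ⟨Φ, fun c i j hij => ?_⟩
    rw [hΦ, Egg.alphaMap_apply, if_neg hij]
  · obtain ⟨Φ, hΦ⟩ := Egg.exists_cohomology_equiv
      (Hochschild.relCochains (Egg.grading k g) (Egg.idempotents k g) (-1))
      Egg.ternaryCochain_mem
      (fun c hc hα => Egg.exists_diff_eq_of_alpha_eq_zero h2 hc (Egg.alphaMap_eq_zero_iff.1 hα))
    refine ⟨Φ, fun c i => ⟨Egg.relCochains_apply_BYA c.2.1 i, fun j hij => ?_⟩⟩
    rw [hΦ, Egg.alphaMap_apply, if_neg hij]
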